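/- Let $\{0,1\}^*$ be enumerated in the standard order $s_0=\lambda,\ s_1=0,\ s_2=1,\ s_3=00,\dots$, and write $A\upharpoonright n$ for the string of the first $n$ bits of the characteristic sequence of a language $A\subseteq\{0,1\}^*$, whose $i$-th bit is $1$ if and only if $s_i\in A$. For $g:\{0,1\}^*\to\{0,1\}^*$ let $\mathrm{p}^g$ be the class of all functions $f:\{0,1\}^*\to\{0,1\}^*$ that are computable in polynomial time by a machine with function oracle $g$ (where an oracle query also costs the length of the answer), and let $\mathrm{p}$ be the class of all functions computable in polynomial time without an oracle. Let $\langle\cdot,\cdot\rangle$ be a standard pairing function on $\{0,1\}^*$. A language $B$ is *$\mathrm{p}^g$-selective* if there is $f\in\mathrm{p}^g$ such that for all $a,b\in\{0,1\}^*$ we have $f(\langle a,b\rangle)\in\{a,b\}$, and $f(\langle a,b\rangle)\in B$ whenever $a\in B$ or $b\in B$. We write $A\le^P_m B$ if there is $h\in\mathrm{p}$ such that for all $x\in\{0,1\}^*$, $x\in A$ if and only if $h(x)\in B$. For $s\in[0,\infty)$, an *$s$-gale* is a function $d:\{0,1\}^*\to[0,\infty)$ with $d(w)=2^{-s}[d(w0)+d(w1)]$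 for all $w$; it *succeeds* on $A$ if $\limsup_{n\to\infty}d(A\upharpoonright n)=\infty$; and it is *$\mathrm{p}^g$-computable* if there is $\hat d:\mathbb{N}\times\{0,1\}^*\to\mathbb{Q}\cap[0,\infty)$ in $\mathrm{p}^g$ (with the first argument coded in unary and the value in binary) such that $|\hat d(r,w)-d(w)|\le 2^{-r}$ for all $r$ and $w$. The *$\mathrm{p}^g$-dimension* $\dim_{\mathrm p}^g(A)$ is the infimum of all $s\in[0,\infty)$ for which some $\mathrm{p}^g$-computable $s$-gale succeeds on $A$. **Theorem.** Let $g:\{0,1\}^*\to\{0,1\}^*$ and let $A,B\subseteq\{0,1\}^*$ be languages such that $B$ is $\mathrm{p}^g$-selective and $A\le^P_m B$. Then $\dim_{\mathrm p}^g(A)=0$. -/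

import Mathlib

open scoped NNReal ENNReal

namespace SelDim

/-! ### Strings, languages and codings -/

/-- Binary strings, the elements of `{0,1}*`; `false` is the bit 0 and `true` the bit 1. -/
abbrev Str : Type := List Bool

/-- The standard pairing `⟨a, b⟩`: every bit of `a` preceded by a 1, then a 0, then `b`. -/
def pair (a b : Str) : Str := a.flatMap (fun x => [true, x]) ++ false :: b

/-- The number `r` in unary. -/
def unary (r : ℕ) : Str := List.replicate r true

/-- The string `y` is a binary code of the nonnegative rational `q`: it is the pair of the binary
numerals (least significant bit first) of a numerator and a nonzero denominator of `q`. -/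
def CodesRat (y : Str) (q : ℚ≥0) : Prop :=
  ∃ a b : ℕ, b ≠ 0 ∧ y = pair a.bits b.bits ∧ q = (a : ℚ≥0) / (b : ℚ≥0)

/-- The standard (length-lexicographic) enumeration `λ, 0, 1, 00, 01, 10, 11, 000, …` of `{0,1}*`:
the binary expansion of `n + 1`, most significant bit first, without its leading 1. -/
def stdString (n : ℕ) : Str := ((n + 1).bits.dropLast).reverse

open Classical in
/-- The prefix of length `n` of the characteristic sequence of the language `A`. -/
noncomputable def charPrefix (A : Set Str) (n : ℕ) : Str :=
  (List.range n).map (fun i => decide (stdString i ∈ A))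

/-! ### Oracle machines

A machine has a finite program acting on finitely many stacks of bits (those that its program
mentions), as in Mathlib's multi-stack model `Turing.TM2` of Turing machines; a pair of stacks is a
Turing machine tape. In addition it may query a function oracle. -/

/-- Instructions. Jump targets are addresses in the program. -/
inductive Instr : Type
  /-- push the bit `b` on stack `i` -/
  | push (i : ℕ) (b : Bool)
  /-- pop stack `i` and jump to `l₀` or `l₁` if the removed bit was 0 or 1;
  jump to `le` if the stack was empty -/
  | pop (i : ℕ) (le l₀ l₁ : ℕ)
  /-- jump to `l` -/
  | jump (l : ℕ)
  /-- ask the oracle for its value at the content of stack `i`, and write the answer on stack `j`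
  in place of its content -/
  | query (i j : ℕ)

/-- Configurations: the address of the next instruction and the contents of the stacks, the top
of a stack being the head of the list. -/
structure Cfg : Type where
  pc : ℕ
  stk : ℕ → Str

/-- One step of the program `P` with the oracle `g`, with its time cost; `none` if the machine has
halted, which happens when there is no instruction at the current address. Every instruction costs
one unit of time, and an oracle query moreover costs one unit for each bit of the answer. -/
def step (g : Str → Str) (P : List Instr) (c : Cfg) : Option (Cfg × ℕ) :=
  match P[c.pc]? with
  | none => none
  | some (.push i b) => some (⟨c.pc + 1, Function.update c.stk i (b :: c.stk i)⟩, 1)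
  | some (.pop i le l₀ l₁) =>
    match c.stk i with
    | [] => some (⟨le, c.stk⟩, 1)
    | false :: u => some (⟨l₀, Function.update c.stk i u⟩, 1)
    | true :: u => some (⟨l₁, Function.update c.stk i u⟩, 1)
  | some (.jump l) => some (⟨l, c.stk⟩, 1)
  | some (.query i j) =>
    some (⟨c.pc + 1, Function.update c.stk j (g (c.stk i))⟩, 1 + (g (c.stk i)).length)

/-- `RunsIn g P c t c'`: the machine gets from `c` to `c'` in exactly `t` units of time. -/
inductive RunsIn (g : Str → Str) (P : List Instr) : Cfg → ℕ → Cfg → Prop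
  | refl (c : Cfg) : RunsIn g P c 0 c
  | head {c c' c'' : Cfg} {k t : ℕ} :
      step g P c = some (c', k) → RunsIn g P c' t c'' → RunsIn g P c (k + t) c''

/-- The initial configuration: the input on stack 0 and all other stacks empty. -/
def initCfg (x : Str) : Cfg := ⟨0, Function.update (fun _ => []) 0 x⟩

/-- With oracle `g`, the program `P` computes `f` within time `T(|x|)` on every input `x`: it halts,
with the output on stack 0. -/
def ComputesInTime (g : Str → Str) (P : List Instr) (f : Str → Str) (T : ℕ → ℕ) : Prop :=
  ∀ x : Str, ∃ (t : ℕ) (c : Cfg),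
    RunsIn g P (initCfg x) t c ∧ step g P c = none ∧ c.stk 0 = f x ∧ t ≤ T x.length

/-- A program without oracle queries. -/
def QueryFree (P : List Instr) : Prop := ∀ i j : ℕ, Instr.query i j ∉ P

/-- The resource bound `p`: the functions computable in polynomial time (without an oracle; the
oracle argument is irrelevant for a program without queries). -/
def p : Set (Str → Str) :=
  {f | ∃ (P : List Instr) (T : Polynomial ℕ),
    QueryFree P ∧ ComputesInTime (fun _ => []) P f (fun n => T.eval n)}

/-- The resource bound `p^g`: the functions computable in polynomial time with the function
oracle `g`. -/
def pRel (g : Str → Str) : Set (Str → Str) :=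
  {f | ∃ (P : List Instr) (T : Polynomial ℕ), ComputesInTime g P f (fun n => T.eval n)}

/-! ### Gales and resource-bounded dimension -/

/-- `d` is an `s`-gale. -/
def IsGale (s : ℝ≥0) (d : Str → ℝ≥0) : Prop :=
  ∀ w : Str, d w = (2 : ℝ≥0) ^ (-(s : ℝ)) * (d (w ++ [false]) + d (w ++ [true]))

/-- `d` succeeds on `A`: the upper limit of `d` along the prefixes of `A` is infinite. -/
def Succeeds (d : Str → ℝ≥0) (A : Set Str) : Prop :=
  Filter.limsup (fun n : ℕ => (d (charPrefix A n) : ℝ≥0∞)) Filter.atTop = ⊤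

/-- The real-valued function `d` is `Δ`-computable: some function in `Δ` computes from the precision
`r`, in unary, and `w` a rational number, in binary, that is within `2^(-r)` of `d w`. -/
def RealComputable (Δ : Set (Str → Str)) (d : Str → ℝ≥0) : Prop :=
  ∃ dhat : ℕ → Str → ℚ≥0,
    (∀ (r : ℕ) (w : Str), |((dhat r w : ℚ≥0) : ℝ) - (d w : ℝ)| ≤ (2 : ℝ) ^ (-(r : ℤ))) ∧
    ∃ F ∈ Δ, ∀ (r : ℕ) (w : Str), CodesRat (F (pair (unary r) w)) (dhat r w)

/-- The set of all `s ∈ [0,∞)` such that some `Δ`-computable `s`-gale succeeds on every element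
of `X`. -/
def galeSet (Δ : Set (Str → Str)) (X : Set (Set Str)) : Set ℝ≥0 :=
  {s | ∃ d : Str → ℝ≥0, IsGale s d ∧ RealComputable Δ d ∧ ∀ A ∈ X, Succeeds d A}

/-- The `Δ`-dimension of a class `X` of languages (an infimum in `[0,∞]`, so that it would be `∞`,
not `0`, if there were no suitable `s`). -/
noncomputable def dimClass (Δ : Set (Str → Str)) (X : Set (Set Str)) : ℝ≥0∞ :=
  ⨅ s ∈ galeSet Δ X, (s : ℝ≥0∞)

/-- The `Δ`-dimension of a language. -/
noncomputable def dim (Δ : Set (Str → Str)) (A : Set Str) : ℝ≥0∞ := dimClass Δ {A}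

/-! ### Selectivity and reducibility -/

/-- `B` is `Δ`-selective: it has a selector function in `Δ`. -/
def Selective (Δ : Set (Str → Str)) (B : Set Str) : Prop :=
  ∃ f ∈ Δ, ∀ a b : Str,
    (f (pair a b) = a ∨ f (pair a b) = b) ∧ (a ∈ B ∨ b ∈ B → f (pair a b) ∈ B)

/-- Polynomial-time many-one reducibility of `A` to `B`. -/
def ManyOnePoly (A B : Set Str) : Prop := ∃ h ∈ p, ∀ x : Str, x ∈ A ↔ h x ∈ B

end SelDim

namespace SelDim

open Function (update)

/-! ### Position-dependent code fragments -/

/-! Composing the reduction with the selector gives a polynomial-time comparison of any two strings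
`a`, `b`, which says either that `b ∈ A` implies `a ∈ A` or that `a ∈ A` implies `b ∈ A`. Among the
`2 ^ N` conceivable restrictions of `A` to a block of `N` consecutive strings, those compatible with
all comparisons form a chain under inclusion, so there are at most `N + 1` of them (`card_cuts_le`).
Predicting each bit by the majority of the candidates still alive at least halves their number with
every mistake, so a block costs at most `log₂ (N + 1)` mistakes (`two_pow_misses_majority`,
`two_pow_misses_charPrefix`).

A gambler betting on these predictions multiplies the capital by `1 + 1/D` when right and by `1/D`
when wrong. This is an `s`-gale for `2 ^ s = 1 + 2/D`. With `D = 2 ^ k` fixed, the gain over a block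
is exponential in `N`, while the loss is only polynomial in `N`; hence some constant `N` makes every
block profitable (`exists_block_length`), and the gale succeeds (`succeeds_predictorGale`). As `k`
grows, `s` tends to `0`.

Since `N` and `k` are constants, a prediction needs `N * N` comparisons and a finite table, and the
capital is a rational number with numerals of linear length (`realComputable_predictorGale`). To
carry this out on the concrete machines, `InPlace` describes `pRel g` by relocatable code
(`inPlace_iff_mem_pRel`), for which closure under composition, pairing, case distinction and bounded
iteration is proved. -/

/-- Contents of all stacks. -/
abbrev Store : Type := ℕ → Str

/-- A code fragment, as a function of the address at which it is placed. -/
abbrev Frag : Type := ℕ → List Instr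

theorem RunsIn.trans {g : Str → Str} {P : List Instr} {c c' c'' : Cfg} {t t' : ℕ}
    (h : RunsIn g P c t c') (h' : RunsIn g P c' t' c'') : RunsIn g P c (t + t') c'' := by
  induction h with
  | refl => simpa using h'
  | head hs _ ih => rw [add_assoc]; exact .head hs (ih h')

theorem RunsIn.single {g : Str → Str} {P : List Instr} {c c' : Cfg} {t : ℕ}
    (h : step g P c = some (c', t)) : RunsIn g P c t c' := by
  simpa using RunsIn.head h (.refl c')

/-- Wherever the fragment `c` is placed, it leads from the store `σ` to the store `σ'` within time
`T`, and is left at its end. -/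
def Runs (g : Str → Str) (c : Frag) (σ : Store) (T : ℕ) (σ' : Store) : Prop :=
  ∀ pre suf : List Instr, ∃ t ≤ T,
    RunsIn g (pre ++ c pre.length ++ suf) ⟨pre.length, σ⟩ t
      ⟨pre.length + (c pre.length).length, σ'⟩

namespace Frag

def nil : Frag := fun _ => []

def push (i : ℕ) (b : Bool) : Frag := fun _ => [.push i b]

def seq (c d : Frag) : Frag := fun o => c o ++ d (o + (c o).length)

/-- Pop stack `i`; run `ce` if it was empty and `c b` if the removed bit is `b`. -/
def branch (i : ℕ) (ce : Frag) (c : Bool → Frag) : Frag := fun o =>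
  let p0 := c false (o + 1)
  let l1 := o + 1 + p0.length + 1
  let p1 := c true l1
  let l2 := l1 + p1.length + 1
  let pe := ce l2
  .pop i l2 (o + 1) l1 :: (p0 ++ .jump (l2 + pe.length) :: (p1 ++ .jump (l2 + pe.length) :: pe))

/-- Pop stack `i` until it is empty, running `c b` after the removal of a bit `b`. -/
def loop (i : ℕ) (c : Bool → Frag) : Frag := fun o =>
  let p0 := c false (o + 1)
  let l1 := o + 1 + p0.length + 1
  let p1 := c true l1
  .pop i (l1 + p1.length + 1) (o + 1) l1 :: (p0 ++ .jump o :: (p1 ++ [.jump o]))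

end Frag

open Frag

variable {g : Str → Str}

/-! ### Execution and cost of the code combinators -/

theorem Runs.mono {c : Frag} {σ σ' : Store} {T T' : ℕ} (h : Runs g c σ T σ') (hT : T ≤ T') :
    Runs g c σ T' σ' := fun pre suf =>
  let ⟨t, ht, hr⟩ := h pre suf
  ⟨t, ht.trans hT, hr⟩

theorem Runs.of_eq {c : Frag} {σ σ' τ : Store} {T : ℕ} (h : Runs g c σ T σ') (hτ : σ' = τ) :
    Runs g c σ T τ := hτ ▸ h

theorem Runs.nil (σ : Store) : Runs g Frag.nil σ 0 σ := fun _ _ =>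
  ⟨0, le_rfl, .refl _⟩

theorem Runs.push (i : ℕ) (b : Bool) (σ : Store) :
    Runs g (Frag.push i b) σ 1 (update σ i (b :: σ i)) := fun pre suf =>
  ⟨1, le_rfl, .single (by simp [step, Frag.push])⟩

theorem Runs.seq {c d : Frag} {σ σ' σ'' : Store} {T T' : ℕ} (h : Runs g c σ T σ')
    (h' : Runs g d σ' T' σ'') : Runs g (Frag.seq c d) σ (T + T') σ'' := fun pre suf => by
  obtain ⟨t, ht, hr⟩ := h pre (d (pre.length + (c pre.length).length) ++ suf)
  obtain ⟨t', ht', hr'⟩ := h' (pre ++ c pre.length) suf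
  refine ⟨t + t', by omega, RunsIn.trans (c' := ⟨pre.length + (c pre.length).length, σ'⟩) ?_ ?_⟩
  · simpa [Frag.seq] using hr
  · simpa [Frag.seq, add_assoc] using hr'

/-- The code for the empty case is placed last, so it runs into the end of the fragment without a
jump; only the pop is added to the cost. -/
theorem Runs.branch_nil {i : ℕ} {ce : Frag} {c : Bool → Frag} {σ σ' : Store} {T : ℕ}
    (hi : σ i = []) (h : Runs g ce σ T σ') :
    Runs g (Frag.branch i ce c) σ (T + 1) σ' := fun pre suf => by
  set p0 := c false (pre.length + 1) with hp0
  set p1 := c true (pre.length + 1 + p0.length + 1) with hp1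
  set pe := ce (pre.length + 1 + p0.length + 1 + p1.length + 1) with hpe
  set l2 := pre.length + 1 + p0.length + 1 + p1.length + 1 with hl2
  obtain ⟨t, ht, hr⟩ := h (pre ++ .pop i l2 (pre.length + 1) (pre.length + 1 + p0.length + 1) ::
    (p0 ++ .jump (l2 + pe.length) :: (p1 ++ [.jump (l2 + pe.length)]))) suf
  have hlen : (pre ++ Instr.pop i l2 (pre.length + 1) (pre.length + 1 + p0.length + 1) ::
    (p0 ++ .jump (l2 + pe.length) :: (p1 ++ [.jump (l2 + pe.length)]))).length = l2 := by
    simp; omega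
  rw [hlen] at hr
  refine ⟨1 + t, by omega, .head (c' := ⟨l2, σ⟩) ?_ ?_⟩
  · simp [step, Frag.branch, hi, ← hp0, ← hp1, ← hl2]
  · have : pre.length + (Frag.branch i ce c pre.length).length = l2 + pe.length := by
      simp [Frag.branch, ← hp0, ← hp1, ← hl2, ← hpe]; omega
    rw [this]
    simpa [Frag.branch, ← hp0, ← hp1, ← hl2, ← hpe] using hr

theorem Runs.branch_cons {i : ℕ} {ce : Frag} {c : Bool → Frag} {σ σ' : Store} {T : ℕ} {b : Bool}
    {u : Str} (hi : σ i = b :: u) (h : Runs g (c b) (update σ i u) T σ') :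
    Runs g (Frag.branch i ce c) σ (T + 2) σ' := fun pre suf => by
  set p0 := c false (pre.length + 1) with hp0
  set p1 := c true (pre.length + 1 + p0.length + 1) with hp1
  set pe := ce (pre.length + 1 + p0.length + 1 + p1.length + 1) with hpe
  set l2 := pre.length + 1 + p0.length + 1 + p1.length + 1 with hl2
  have hend : pre.length + (Frag.branch i ce c pre.length).length = l2 + pe.length := by
    simp [Frag.branch, ← hp0, ← hp1, ← hl2, ← hpe]; omega
  rw [hend]
  cases b with
  | false =>
    obtain ⟨t, ht, hr⟩ := h
      (pre ++ [.pop i l2 (pre.length + 1) (pre.length + 1 + p0.length + 1)])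
      (.jump (l2 + pe.length) :: (p1 ++ .jump (l2 + pe.length) :: pe) ++ suf)
    refine ⟨1 + (t + 1), by omega, .head (c' := ⟨pre.length + 1, update σ i u⟩) ?_
      (RunsIn.trans (c' := ⟨pre.length + 1 + p0.length, σ'⟩) ?_ (.single ?_))⟩
    · simp [step, Frag.branch, hi]
    · simpa [Frag.branch, ← hp0, ← hp1, ← hl2, ← hpe] using hr
    · have : (pre ++ Frag.branch i ce c pre.length ++ suf)[pre.length + 1 + p0.length]? =
          some (.jump (l2 + pe.length)) := by
        simp only [Frag.branch, ← hp0, ← hp1, ← hl2, ← hpe]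
        rw [List.append_assoc, List.getElem?_append_right (by omega)]
        rw [show pre.length + 1 + p0.length - pre.length = p0.length + 1 by omega]
        simp
      simp only [step, this]
  | true =>
    obtain ⟨t, ht, hr⟩ := h
      (pre ++ .pop i l2 (pre.length + 1) (pre.length + 1 + p0.length + 1) ::
        (p0 ++ [.jump (l2 + pe.length)]))
      (.jump (l2 + pe.length) :: pe ++ suf)
    have hlen : (pre ++ Instr.pop i l2 (pre.length + 1) (pre.length + 1 + p0.length + 1) ::
        (p0 ++ [.jump (l2 + pe.length)])).length = pre.length + 1 + p0.length + 1 := by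
      simp; omega
    rw [hlen] at hr
    refine ⟨1 + (t + 1), by omega,
      .head (c' := ⟨pre.length + 1 + p0.length + 1, update σ i u⟩) ?_
      (RunsIn.trans (c' := ⟨pre.length + 1 + p0.length + 1 + p1.length, σ'⟩) ?_ (.single ?_))⟩
    · simp [step, Frag.branch, hi, ← hp0]
    · simpa [Frag.branch, ← hp0, ← hp1, ← hl2, ← hpe] using hr
    · have : (pre ++ Frag.branch i ce c pre.length ++ suf)[pre.length + 1 + p0.length + 1 +
          p1.length]? = some (.jump (l2 + pe.length)) := by
        simp only [Frag.branch, ← hp0, ← hp1, ← hl2, ← hpe]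
        rw [List.append_assoc, List.getElem?_append_right (by omega)]
        rw [show pre.length + 1 + p0.length + 1 + p1.length - pre.length =
          p0.length + (p1.length + 1) + 1 by omega]
        simp
      simp only [step, this]

theorem Runs.loop_nil {i : ℕ} {c : Bool → Frag} {σ : Store} (hi : σ i = []) :
    Runs g (Frag.loop i c) σ 1 σ := fun pre suf => by
  refine ⟨1, le_rfl, .single ?_⟩
  simp [step, Frag.loop, hi]
  omega

/-- The closing jump leads back to the address of the loop itself, so the remaining rounds are a run
of the same code in the same context. The pop and the jump account for the `2`. -/
theorem Runs.loop_cons {i : ℕ} {c : Bool → Frag} {σ σ' σ'' : Store} {T T' : ℕ} {b : Bool}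
    {u : Str} (hi : σ i = b :: u) (h : Runs g (c b) (update σ i u) T σ')
    (h' : Runs g (Frag.loop i c) σ' T' σ'') :
    Runs g (Frag.loop i c) σ (T + 2 + T') σ'' := fun pre suf => by
  obtain ⟨t', ht', hr'⟩ := h' pre suf
  set p0 := c false (pre.length + 1) with hp0
  set p1 := c true (pre.length + 1 + p0.length + 1) with hp1
  set l2 := pre.length + 1 + p0.length + 1 + p1.length + 1 with hl2
  cases b with
  | false =>
    obtain ⟨t, ht, hr⟩ := h
      (pre ++ [.pop i l2 (pre.length + 1) (pre.length + 1 + p0.length + 1)])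
      (.jump pre.length :: (p1 ++ [.jump pre.length]) ++ suf)
    refine ⟨1 + (t + (1 + t')), by omega, .head (c' := ⟨pre.length + 1, update σ i u⟩) ?_
      (RunsIn.trans (c' := ⟨pre.length + 1 + p0.length, σ'⟩) ?_
        (.head (c' := ⟨pre.length, σ'⟩) ?_ hr'))⟩
    · simp [step, Frag.loop, hi]
    · simpa [Frag.loop, ← hp0, ← hp1, ← hl2] using hr
    · have : (pre ++ Frag.loop i c pre.length ++ suf)[pre.length + 1 + p0.length]? =
          some (.jump pre.length) := by
        simp only [Frag.loop, ← hp0, ← hp1, ← hl2]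
        rw [List.append_assoc, List.getElem?_append_right (by omega)]
        rw [show pre.length + 1 + p0.length - pre.length = p0.length + 1 by omega]
        simp
      simp only [step, this]
  | true =>
    obtain ⟨t, ht, hr⟩ := h
      (pre ++ .pop i l2 (pre.length + 1) (pre.length + 1 + p0.length + 1) ::
        (p0 ++ [.jump pre.length]))
      (.jump pre.length :: suf)
    have hlen : (pre ++ Instr.pop i l2 (pre.length + 1) (pre.length + 1 + p0.length + 1) ::
        (p0 ++ [.jump pre.length])).length = pre.length + 1 + p0.length + 1 := by
      simp; omega
    rw [hlen] at hr
    refine ⟨1 + (t + (1 + t')), by omega,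
      .head (c' := ⟨pre.length + 1 + p0.length + 1, update σ i u⟩) ?_
      (RunsIn.trans (c' := ⟨pre.length + 1 + p0.length + 1 + p1.length, σ'⟩) ?_
        (.head (c' := ⟨pre.length, σ'⟩) ?_ hr'))⟩
    · simp [step, Frag.loop, hi, ← hp0]
    · simpa [Frag.loop, ← hp0, ← hp1, ← hl2] using hr
    · have : (pre ++ Frag.loop i c pre.length ++ suf)[pre.length + 1 + p0.length + 1 +
          p1.length]? = some (.jump pre.length) := by
        simp only [Frag.loop, ← hp0, ← hp1, ← hl2]
        rw [List.append_assoc, List.getElem?_append_right (by omega)]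
        rw [show pre.length + 1 + p0.length + 1 + p1.length - pre.length =
          p0.length + (p1.length + 1) + 1 by omega]
        simp
      simp only [step, this]

/-- No step lengthens a stack by more than its cost. For queries this holds because the length of
the answer is charged. -/
theorem RunsIn.length_le {P : List Instr} {c c' : Cfg} {t : ℕ} (h : RunsIn g P c t c') (m : ℕ) :
    (c'.stk m).length ≤ (c.stk m).length + t := by
  induction h with
  | refl => simp
  | @head c c' c'' k t hs _ ih =>
    have : (c'.stk m).length ≤ (c.stk m).length + k := by
      unfold step at hs
      split at hs
      · simp at hs
      · simp only [Option.some.injEq, Prod.mk.injEq] at hs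
        obtain ⟨rfl, rfl⟩ := hs
        simp only [Function.update_apply]
        split_ifs with hm <;> simp [hm]
      · split at hs <;> simp only [Option.some.injEq, Prod.mk.injEq] at hs <;>
          obtain ⟨rfl, rfl⟩ := hs <;> simp only [Function.update_apply]
        · omega
        all_goals
          split_ifs with hm
          · subst hm; simp [*]; omega
          · omega
      · simp only [Option.some.injEq, Prod.mk.injEq] at hs
        obtain ⟨rfl, rfl⟩ := hs
        simp
      · simp only [Option.some.injEq, Prod.mk.injEq] at hs
        obtain ⟨rfl, rfl⟩ := hs
        simp only [Function.update_apply]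
        split_ifs <;> omega
    omega

theorem Runs.length_le {c : Frag} {σ σ' : Store} {T : ℕ} (h : Runs g c σ T σ') (m : ℕ) :
    (σ' m).length ≤ (σ m).length + T := by
  obtain ⟨t, ht, hr⟩ := h [] []
  have := hr.length_le m
  simp only at this
  omega

/-! ### Moving data between stacks -/

namespace Frag

/-- Empty stack `i`. -/
def clear (i : ℕ) : Frag := loop i fun _ => nil

/-- Empty stack `i` onto stack `j`, which reverses the order of its bits. -/
def pour (i j : ℕ) : Frag := loop i fun b => push j b

/-- Empty stack `i` onto both of the stacks `j` and `k`. -/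
def pourBoth (i j k : ℕ) : Frag := loop i fun b => seq (push j b) (push k b)

/-- Empty stack `i` onto stack `j`, adding a bit 1 on top of each of its bits. -/
def pourMarked (i j : ℕ) : Frag := loop i fun b => seq (push j b) (push j true)

/-- Put the content of stack `i` on top of stack `j`, using stack `s`. -/
def move (i j s : ℕ) : Frag := seq (pour i s) (pour s j)

/-- Put a copy of the content of stack `i` on top of stack `j`, using stack `s`. -/
def copy (i j s : ℕ) : Frag := seq (pour i s) (pourBoth s i j)

/-- Push the string `v`. -/
def pushStr (i : ℕ) : Str → Frag
  | [] => nil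
  | b :: v => seq (pushStr i v) (push i b)

/-- Empty the stacks `k + 1, …, k + n`. -/
def clearAbove (k : ℕ) : ℕ → Frag
  | 0 => nil
  | n + 1 => seq (clearAbove k n) (clear (k + n + 1))

end Frag

theorem Runs.clear (i : ℕ) (σ : Store) :
    Runs g (Frag.clear i) σ (2 * (σ i).length + 1) (update σ i []) := by
  generalize hl : σ i = l
  induction l generalizing σ with
  | nil => exact (Runs.loop_nil hl).of_eq (by rw [← hl, Function.update_eq_self])
  | cons b l ih =>
    refine ((Runs.loop_cons hl (Runs.nil _) (ih _ (by simp))).of_eq (by simp)).mono ?_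
    simp; omega

theorem Runs.pour {i j : ℕ} (hij : i ≠ j) (σ : Store) :
    Runs g (Frag.pour i j) σ (3 * (σ i).length + 1)
      (update (update σ i []) j ((σ i).reverse ++ σ j)) := by
  generalize hl : σ i = l
  induction l generalizing σ with
  | nil =>
    refine (Runs.loop_nil hl).of_eq ?_
    ext1 m
    grind [Function.update_apply]
  | cons b l ih =>
    refine ((Runs.loop_cons hl (Runs.push _ _ _) (ih _ ?_)).of_eq ?_).mono ?_
    · simp [Function.update_apply, hij]
    · ext1 m
      simp only [Function.update_apply]
      split_ifs <;> simp_all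
    · simp; omega

theorem Runs.pourBoth {i j k : ℕ} (hij : i ≠ j) (hik : i ≠ k) (hjk : j ≠ k) (σ : Store) :
    Runs g (Frag.pourBoth i j k) σ (4 * (σ i).length + 1)
      (update (update (update σ i []) j ((σ i).reverse ++ σ j)) k ((σ i).reverse ++ σ k)) := by
  generalize hl : σ i = l
  induction l generalizing σ with
  | nil =>
    refine (Runs.loop_nil hl).of_eq ?_
    ext1 m
    grind [Function.update_apply]
  | cons b l ih =>
    refine ((Runs.loop_cons hl ((Runs.push _ _ _).seq (Runs.push _ _ _)) (ih _ ?_)).of_eq ?_).mono ?_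
    · simp [Function.update_apply, hij, hik]
    · ext1 m
      simp only [Function.update_apply]
      split_ifs <;> simp_all
    · simp; omega

theorem Runs.pourMarked {i j : ℕ} (hij : i ≠ j) (σ : Store) :
    Runs g (Frag.pourMarked i j) σ (4 * (σ i).length + 1)
      (update (update σ i []) j ((σ i).reverse.flatMap (fun x => [true, x]) ++ σ j)) := by
  generalize hl : σ i = l
  induction l generalizing σ with
  | nil =>
    refine (Runs.loop_nil hl).of_eq ?_
    ext1 m
    grind [Function.update_apply]
  | cons b l ih =>
    refine ((Runs.loop_cons hl ((Runs.push _ _ _).seq (Runs.push _ _ _)) (ih _ ?_)).of_eq ?_).mono ?_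
    · simp [Function.update_apply, hij]
    · ext1 m
      simp only [Function.update_apply]
      split_ifs <;> simp_all
    · simp; omega

theorem Runs.move {i j s : ℕ} (hij : i ≠ j) (his : i ≠ s) (hjs : j ≠ s) {σ : Store}
    (hs : σ s = []) :
    Runs g (Frag.move i j s) σ (6 * (σ i).length + 2)
      (update (update σ i []) j (σ i ++ σ j)) := by
  refine (((Runs.pour his σ).seq (Runs.pour hjs.symm _)).of_eq ?_).mono ?_
  · ext1 m
    simp only [Function.update_apply]
    split_ifs <;> simp_all
  · simp [hs]; omega

theorem Runs.copy {i j s : ℕ} (hij : i ≠ j) (his : i ≠ s) (hjs : j ≠ s) {σ : Store}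
    (hs : σ s = []) :
    Runs g (Frag.copy i j s) σ (7 * (σ i).length + 2) (update σ j (σ i ++ σ j)) := by
  refine (((Runs.pour his σ).seq (Runs.pourBoth his.symm hjs.symm hij _)).of_eq ?_).mono ?_
  · ext1 m
    simp only [Function.update_apply]
    split_ifs <;> simp_all
  · simp [hs]; omega

theorem Runs.pushStr (i : ℕ) (v : Str) (σ : Store) :
    Runs g (Frag.pushStr i v) σ v.length (update σ i (v ++ σ i)) := by
  induction v with
  | nil => exact (Runs.nil σ).of_eq (by simp)
  | cons b v ih =>
    refine ((ih.seq (Runs.push i b _)).of_eq (by simp)).mono (by simp)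

theorem Runs.clearAbove (k n : ℕ) (σ : Store) (B : ℕ) (hB : ∀ m, k < m → (σ m).length ≤ B) :
    Runs g (Frag.clearAbove k n) σ (n * (2 * B + 1))
      (fun m => if k < m ∧ m ≤ k + n then [] else σ m) := by
  induction n with
  | zero => exact ((Runs.nil σ).of_eq (by ext1 m; split_ifs <;> [omega; rfl])).mono (by simp)
  | succ n ih =>
    refine ((ih.seq (Runs.clear _ _)).of_eq ?_).mono ?_
    · ext1 m
      simp only [Function.update_apply]
      split_ifs <;> first | rfl | omega
    · have := hB (k + n + 1) (by omega)
      rw [Nat.add_mul, one_mul, if_neg (by omega)]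
      omega

/-! ### Embedding programs -/

/-- Shift the stacks of an instruction by `k` and move its addresses below `n` by `o`; all other
addresses become the end address. -/
def Instr.shift (k o n : ℕ) : Instr → Instr
  | .push i b => .push (i + k) b
  | .pop i le l₀ l₁ => .pop (i + k) (o + min le n) (o + min l₀ n) (o + min l₁ n)
  | .jump l => .jump (o + min l n)
  | .query i j => .query (i + k) (j + k)

/-- The program `P` working on the stacks from `k` on. -/
def Frag.embed (P : List Instr) (k : ℕ) : Frag := fun o => P.map (Instr.shift k o P.length)

/-- The store that is `σ` below `k`, and `s` from `k` on. -/
def Store.glue (k : ℕ) (σ s : Store) : Store := fun m => if m < k then σ m else s (m - k)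

theorem Store.update_glue (k : ℕ) (σ s : Store) (i : ℕ) (v : Str) :
    update (Store.glue k σ s) (i + k) v = Store.glue k σ (update s i v) := by
  ext1 m
  simp only [Store.glue, Function.update_apply]
  split_ifs <;> first | rfl | omega

theorem Store.glue_apply_add (k : ℕ) (σ s : Store) (i : ℕ) :
    Store.glue k σ s (i + k) = s i := by simp [Store.glue]

theorem step_eq_none {P : List Instr} {c : Cfg} : step g P c = none ↔ P.length ≤ c.pc := by
  rw [← List.getElem?_eq_none_iff]
  unfold step
  constructor
  · intro h
    split at h
    · assumption
    · simp at h
    · split at h <;> simp at h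
    · simp at h
    · simp at h
  · intro h
    simp [h]

/-- Every address beyond the program means halting, so capping addresses at `P.length` identifies
all halting addresses with the end of the fragment and leaves the others intact. -/
theorem step_embed {P : List Instr} {k : ℕ} {c c' : Cfg} {t : ℕ} (h : step g P c = some (c', t))
    (σ : Store) (pre suf : List Instr) :
    step g (pre ++ Frag.embed P k pre.length ++ suf)
      ⟨pre.length + min c.pc P.length, Store.glue k σ c.stk⟩ =
      some (⟨pre.length + min c'.pc P.length, Store.glue k σ c'.stk⟩, t) := by
  have hlt : c.pc < P.length := by
    by_contra hn
    rw [step_eq_none.2 (not_lt.1 hn)] at h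
    cases h
  have hget : (pre ++ Frag.embed P k pre.length ++ suf)[pre.length + min c.pc P.length]? =
      (P[c.pc]?).map (Instr.shift k pre.length P.length) := by
    rw [List.append_assoc, List.getElem?_append_right (by omega), List.getElem?_append_left]
    · simp [Frag.embed, min_eq_left hlt.le]
    · simp [Frag.embed]; omega
  have hpc : pre.length + min c.pc P.length + 1 = pre.length + min (c.pc + 1) P.length := by omega
  unfold step at h ⊢
  simp only [hget]
  split at h
  · cases h
  · rename_i hP
    simp only [Option.some.injEq, Prod.mk.injEq] at h
    obtain ⟨rfl, rfl⟩ := h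
    simp only [hP, Option.map_some, Instr.shift, Store.glue_apply_add, Store.update_glue, hpc]
  · rename_i hP
    simp only [hP, Option.map_some, Instr.shift, Store.glue_apply_add]
    split at h <;> simp only [Option.some.injEq, Prod.mk.injEq] at h <;>
      obtain ⟨rfl, rfl⟩ := h <;> simp only [Store.update_glue]
  · rename_i hP
    simp only [Option.some.injEq, Prod.mk.injEq] at h
    obtain ⟨rfl, rfl⟩ := h
    simp only [hP, Option.map_some, Instr.shift]
  · rename_i hP
    simp only [Option.some.injEq, Prod.mk.injEq] at h
    obtain ⟨rfl, rfl⟩ := h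
    simp only [hP, Option.map_some, Instr.shift, Store.glue_apply_add, Store.update_glue, hpc]

theorem RunsIn.embed {P : List Instr} {k : ℕ} {c c' : Cfg} {t : ℕ} (h : RunsIn g P c t c')
    (σ : Store) (pre suf : List Instr) :
    RunsIn g (pre ++ Frag.embed P k pre.length ++ suf)
      ⟨pre.length + min c.pc P.length, Store.glue k σ c.stk⟩ t
      ⟨pre.length + min c'.pc P.length, Store.glue k σ c'.stk⟩ := by
  induction h with
  | refl => exact .refl _
  | head hs _ ih => exact .head (step_embed hs σ pre suf) ih

theorem Runs.embed {P : List Instr} {k : ℕ} {s s' : Store} {pc t T : ℕ}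
    (h : RunsIn g P ⟨0, s⟩ t ⟨pc, s'⟩) (hpc : P.length ≤ pc) (ht : t ≤ T) (σ : Store) :
    Runs g (Frag.embed P k) (Store.glue k σ s) T (Store.glue k σ s') := fun pre suf =>
  ⟨t, ht, by simpa [hpc, Frag.embed] using h.embed (k := k) σ pre suf⟩

/-- The largest stack that an instruction mentions. -/
def Instr.maxStack : Instr → ℕ
  | .push i _ => i
  | .pop i _ _ _ => i
  | .jump _ => 0
  | .query i j => max i j

theorem RunsIn.stk_eq {P : List Instr} {c c' : Cfg} {t : ℕ} (h : RunsIn g P c t c') {m : ℕ}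
    (hm : ∀ x ∈ P, x.maxStack < m) : c'.stk m = c.stk m := by
  induction h with
  | refl => rfl
  | head hs _ ih =>
    rw [ih]
    unfold step at hs
    split at hs
    · cases hs
    · rename_i hP
      have := hm _ (List.mem_of_getElem? hP)
      simp only [Option.some.injEq, Prod.mk.injEq] at hs
      obtain ⟨rfl, rfl⟩ := hs
      exact Function.update_of_ne (by simp only [Instr.maxStack] at this; omega) _ _
    · rename_i hP
      have := hm _ (List.mem_of_getElem? hP)
      split at hs <;> simp only [Option.some.injEq, Prod.mk.injEq] at hs <;>
        obtain ⟨rfl, rfl⟩ := hs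
      · rfl
      · exact Function.update_of_ne (by simp only [Instr.maxStack] at this; omega) _ _
      · exact Function.update_of_ne (by simp only [Instr.maxStack] at this; omega) _ _
    · simp only [Option.some.injEq, Prod.mk.injEq] at hs
      obtain ⟨rfl, rfl⟩ := hs
      rfl
    · rename_i hP
      have := hm _ (List.mem_of_getElem? hP)
      simp only [Option.some.injEq, Prod.mk.injEq] at hs
      obtain ⟨rfl, rfl⟩ := hs
      exact Function.update_of_ne (by simp only [Instr.maxStack] at this; omega) _ _

theorem exists_maxStack_lt (P : List Instr) : ∃ S, ∀ x ∈ P, x.maxStack < S := by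
  induction P with
  | nil => exact ⟨0, by simp⟩
  | cons x P ih =>
    obtain ⟨S, hS⟩ := ih
    refine ⟨max S (x.maxStack + 1), fun y hy => ?_⟩
    rcases List.mem_cons.1 hy with rfl | hy
    · simp
    · exact lt_max_of_lt_left (hS y hy)

theorem RunsIn.of_queryFree {P : List Instr} (hP : QueryFree P) {g' : Str → Str} {c c' : Cfg}
    {t : ℕ} (h : RunsIn g P c t c') : RunsIn g' P c t c' := by
  induction h with
  | refl => exact .refl _
  | head hs _ ih =>
    refine .head ?_ ih
    unfold step at hs ⊢
    split at hs
    · cases hs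
    · simp [*]
    · simp only [*]
    · simp [*]
    · rename_i h
      exact absurd (List.mem_of_getElem? h) (hP _ _)

theorem p_subset_pRel (g : Str → Str) : p ⊆ pRel g := by
  rintro f ⟨P, T, hP, h⟩
  refine ⟨P, T, fun x => ?_⟩
  obtain ⟨t, c, hr, hn, hc, ht⟩ := h x
  exact ⟨t, c, hr.of_queryFree hP, step_eq_none.2 (step_eq_none.1 hn), hc, ht⟩

/-! ### Functions computed in place -/

/-- `f` is computed in polynomial time by fragments that replace the content of the stack `k` by
its value under `f`, using the stacks above `k` as initially empty working space. -/
def InPlace (g : Str → Str) (f : Str → Str) : Prop :=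
  ∃ (c : ℕ → Frag) (Q : Polynomial ℕ), ∀ (k : ℕ) (σ : Store), (∀ m, k < m → σ m = []) →
    Runs g (c k) σ (Q.eval (σ k).length) (update σ k (f (σ k)))

theorem eval_mono (Q : Polynomial ℕ) {m n : ℕ} (h : m ≤ n) : Q.eval m ≤ Q.eval n := by
  rw [Polynomial.eval_eq_sum, Polynomial.eval_eq_sum]
  exact Finset.sum_le_sum fun i _ => Nat.mul_le_mul_left _ (Nat.pow_le_pow_left h i)

/-- The program is shifted to the stacks from `k` on and whatever it leaves above `k` is erased.
Only finitely many stacks can be dirty, since the program mentions finitely many, and their lengths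
are bounded by input length plus running time. -/
theorem inPlace_of_mem_pRel {f : Str → Str} (hf : f ∈ pRel g) : InPlace g f := by
  obtain ⟨P, T, h⟩ := hf
  obtain ⟨S, hS⟩ := exists_maxStack_lt P
  refine ⟨fun k => seq (embed P k) (clearAbove k S),
    T + Polynomial.C S * (2 * (Polynomial.X + T) + 1), fun k σ hσ => ?_⟩
  obtain ⟨t, ⟨pc, s⟩, hr, hn, hc, ht⟩ := h (σ k)
  have hinit : Store.glue k σ (initCfg (σ k)).stk = σ := by
    ext1 m
    simp only [Store.glue, initCfg, Function.update_apply]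
    split_ifs with h1 h2
    · rfl
    · rw [show m = k by omega]
    · rw [hσ m (by omega)]
  have hlen : ∀ m, (s m).length ≤ (σ k).length + T.eval (σ k).length := fun m => by
    have := hr.length_le m
    simp only [initCfg, Function.update_apply] at this
    dsimp only at ht
    split_ifs at this
    · omega
    · simp only [List.length_nil] at this; omega
  have h1 := Runs.embed (k := k) hr (step_eq_none.1 hn) ht σ
  change Runs g _ (Store.glue k σ (initCfg (σ k)).stk) _ _ at h1
  rw [hinit] at h1
  have h2 := Runs.clearAbove (g := g) k S (Store.glue k σ s) _ fun m hm => by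
    simpa only [Store.glue, if_neg (not_lt.2 hm.le)] using hlen (m - k)
  refine ((h1.seq h2).of_eq ?_).mono (by simp)
  ext1 m
  simp only [Function.update_apply, Store.glue]
  split_ifs with h3 h4 h5 h6 h7
  · omega
  · rw [hσ m h3.1]
  · omega
  · rfl
  · rw [← hc, h7, Nat.sub_self]
  · have := hr.stk_eq (m := m - k) (fun x hx => (hS x hx).trans_le (by omega))
    simp only [initCfg] at this
    rw [this, Function.update_of_ne (by omega), hσ m (by omega)]

theorem InPlace.mem_pRel {f : Str → Str} (hf : InPlace g f) : f ∈ pRel g := by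
  obtain ⟨c, Q, h⟩ := hf
  refine ⟨c 0 0, Q, fun x => ?_⟩
  have hx : (initCfg x).stk 0 = x := by simp [initCfg]
  obtain ⟨t, ht, hr⟩ := h 0 (initCfg x).stk
    (fun m hm => by simp [initCfg, Function.update_of_ne hm.ne']) [] []
  rw [hx] at ht hr
  simp only [List.nil_append, List.append_nil, List.length_nil] at hr
  exact ⟨t, _, hr, step_eq_none.2 (by simp), by simp, ht⟩

theorem inPlace_iff_mem_pRel {f : Str → Str} : InPlace g f ↔ f ∈ pRel g :=
  ⟨InPlace.mem_pRel, inPlace_of_mem_pRel⟩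

namespace InPlace

/-- A time bound is also a bound on the growth of the output; this controls the second stage of a
composition. -/
theorem length_le {f : Str → Str} {c : ℕ → Frag} {Q : Polynomial ℕ}
    (h : ∀ (k : ℕ) (σ : Store), (∀ m, k < m → σ m = []) →
      Runs g (c k) σ (Q.eval (σ k).length) (update σ k (f (σ k)))) (x : Str) :
    (f x).length ≤ x.length + Q.eval x.length := by
  have := (h 0 (update (fun _ => []) 0 x)
    (fun m hm => by simp [Function.update_of_ne hm.ne'])).length_le 0
  simpa using this

protected theorem id : InPlace g fun x => x :=
  ⟨fun _ => nil, 0, fun k σ _ => ((Runs.nil σ).of_eq (by simp)).mono (by simp)⟩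

theorem comp {f h : Str → Str} (hf : InPlace g f) (hh : InPlace g h) :
    InPlace g fun x => f (h x) := by
  obtain ⟨c, Q, hc⟩ := hf
  obtain ⟨d, R, hd⟩ := hh
  refine ⟨fun k => seq (d k) (c k), R + Q.comp (Polynomial.X + R), fun k σ hσ => ?_⟩
  refine (((hd k σ hσ).seq (hc k _ fun m hm => ?_)).of_eq (by simp)).mono ?_
  · rw [Function.update_of_ne hm.ne', hσ m hm]
  · simp only [Function.update_self, Polynomial.eval_add, Polynomial.eval_comp,
      Polynomial.eval_X, add_le_add_iff_left]
    exact eval_mono Q (length_le hd _)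

theorem const (v : Str) : InPlace g fun _ => v :=
  ⟨fun k => seq (clear k) (pushStr k v), 2 * Polynomial.X + 1 + Polynomial.C v.length,
    fun k σ _ => (((Runs.clear k σ).seq (Runs.pushStr k v _)).of_eq (by simp)).mono (by simp)⟩

theorem append_const (v : Str) : InPlace g fun x => v ++ x :=
  ⟨fun k => pushStr k v, Polynomial.C v.length, fun k σ _ => (Runs.pushStr k v σ).mono (by simp)⟩

/-- Case distinction on the first bit, which is removed. -/
theorem cases {f : Bool → Str → Str} {fe : Str} (hf : ∀ b, InPlace g (f b)) :
    InPlace g fun x => match x with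
      | [] => fe
      | b :: t => f b t := by
  choose c Q hc using hf
  refine ⟨fun k => branch k (pushStr k fe) (fun b => c b k),
    Polynomial.C fe.length + Q false + Q true + 2, fun k σ hσ => ?_⟩
  rcases hk : σ k with _ | ⟨b, t⟩
  · refine ((Runs.branch_nil hk (Runs.pushStr k fe σ)).of_eq (by simp [hk])).mono ?_
    simp only [Polynomial.eval_add, Polynomial.eval_C, Polynomial.eval_ofNat]
    omega
  · refine ((Runs.branch_cons hk (hc b k _ fun m hm => ?_)).of_eq (by simp)).mono ?_
    · rw [Function.update_of_ne hm.ne', hσ m hm]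
    · have := eval_mono (Q b) (show t.length ≤ (b :: t).length by simp)
      simp only [Function.update_self, Polynomial.eval_add, Polynomial.eval_C,
        Polynomial.eval_ofNat]
      cases b <;> omega

/-- The result is assembled on stack `k` from the bottom: second component, separator, marked bits.
The first component is reversed beforehand, so that pouring it with markers restores its order. The
second copy of the input is made only after `f` has been computed, because `f` needs all higher
stacks empty. -/
theorem pair {f h : Str → Str} (hf : InPlace g f) (hh : InPlace g h) :
    InPlace g fun x => SelDim.pair (f x) (h x) := by
  obtain ⟨c, Q, hc⟩ := hf
  obtain ⟨d, R, hd⟩ := hh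
  refine ⟨fun k => seq (copy k (k + 1) (k + 2)) <| seq (c (k + 1)) <| seq (copy k (k + 2) (k + 3)) <|
    seq (d (k + 2)) <| seq (clear k) <| seq (move (k + 2) k (k + 3)) <| seq (push k false) <|
    seq (pour (k + 1) (k + 3)) (pourMarked (k + 3) k),
    7 * Polynomial.X + 2 + (Q + (7 * Polynomial.X + 2 + (R + (2 * Polynomial.X + 1 +
      (6 * (Polynomial.X + R) + 2 + (1 + (3 * (Polynomial.X + Q) + 1 +
        (4 * (Polynomial.X + Q) + 1)))))))), fun k σ hσ => ?_⟩
  have e1 : σ (k + 1) = [] := hσ _ (by omega)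
  have e2 : σ (k + 2) = [] := hσ _ (by omega)
  have e3 : σ (k + 3) = [] := hσ _ (by omega)
  have hlf := length_le hc (σ k)
  have hlh := length_le hd (σ k)
  have r1 : Runs g (copy k (k + 1) (k + 2)) σ _ (update σ (k + 1) (σ k)) :=
    (Runs.copy (by omega) (by omega) (by omega) e2).of_eq (by rw [e1, List.append_nil])
  have r2 : Runs g (c (k + 1)) _ _ (update σ (k + 1) (f (σ k))) :=
    (hc (k + 1) (update σ (k + 1) (σ k)) fun m hm => by
      rw [Function.update_of_ne hm.ne', hσ m (by omega)]).of_eq (by simp)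
  have r3 : Runs g (copy k (k + 2) (k + 3)) (update σ (k + 1) (f (σ k))) _
      (update (update σ (k + 1) (f (σ k))) (k + 2) (σ k)) :=
    (Runs.copy (by omega) (by omega) (by omega) (by simp [e3])).of_eq (by simp [e2])
  have r4 : Runs g (d (k + 2)) _ _ (update (update σ (k + 1) (f (σ k))) (k + 2) (h (σ k))) :=
    (hd (k + 2) (update (update σ (k + 1) (f (σ k))) (k + 2) (σ k)) fun m hm => by
      rw [Function.update_of_ne hm.ne', Function.update_of_ne (by omega),
        hσ m (by omega)]).of_eq (by simp)
  have r5 : Runs g (clear k) _ _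
      (update (update (update σ (k + 1) (f (σ k))) (k + 2) (h (σ k))) k []) := Runs.clear _ _
  have r6 : Runs g (move (k + 2) k (k + 3))
      (update (update (update σ (k + 1) (f (σ k))) (k + 2) (h (σ k))) k []) _
      (update (update σ (k + 1) (f (σ k))) k (h (σ k))) :=
    (Runs.move (by omega) (by omega) (by omega) (by simp [e3])).of_eq (by
      ext1 m
      simp only [Function.update_apply]
      split_ifs <;> simp_all)
  have r7 : Runs g (push k false) (update (update σ (k + 1) (f (σ k))) k (h (σ k))) _
      (update (update σ (k + 1) (f (σ k))) k (false :: h (σ k))) :=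
    (Runs.push _ _ _).of_eq (by simp)
  have r8 : Runs g (pour (k + 1) (k + 3))
      (update (update σ (k + 1) (f (σ k))) k (false :: h (σ k))) _
      (update (update σ (k + 3) (f (σ k)).reverse) k (false :: h (σ k))) :=
    (Runs.pour (by omega) _).of_eq (by
      ext1 m
      simp only [Function.update_apply]
      split_ifs <;> simp_all)
  have r9 : Runs g (pourMarked (k + 3) k)
      (update (update σ (k + 3) (f (σ k)).reverse) k (false :: h (σ k))) _ (update σ k (SelDim.pair (f (σ k)) (h (σ k)))) :=
    (Runs.pourMarked (by omega) _).of_eq (by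
      ext1 m
      simp only [Function.update_apply]
      split_ifs <;> simp_all [SelDim.pair])
  refine (r1.seq <| r2.seq <| r3.seq <| r4.seq <| r5.seq <| r6.seq <| r7.seq <| r8.seq r9).mono ?_
  simp
  omega

/-- Iteration along a string `l x`, with a polynomial bound on the intermediate results. -/
theorem foldl {step l i : Str → Str} (hs : InPlace g step) (hl : InPlace g l) (hi : InPlace g i)
    (B : Polynomial ℕ)
    (hB : ∀ x v, v <+: l x →
      (v.foldl (fun acc b => step (b :: acc)) (i x)).length ≤ B.eval x.length) :
    InPlace g fun x => (l x).foldl (fun acc b => step (b :: acc)) (i x) := by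
  obtain ⟨c, Q, hc⟩ := hs
  obtain ⟨d, R, hd⟩ := hl
  obtain ⟨e, S, he⟩ := hi
  -- The unread part of the string is on stack `k + 1`, the accumulator on `k + 2`. A round costs a
  -- pop, a push, a jump and one call on a string of length at most `T + 1`.
  have hloop (k : ℕ) (T : ℕ) (v : Str) (σ : Store) (hσ : ∀ m, k + 2 < m → σ m = [])
      (hv : σ (k + 1) = v)
      (hT : ∀ u, u <+: v →
        (u.foldl (fun acc b => step (b :: acc)) (σ (k + 2))).length ≤ T) :
      Runs g (loop (k + 1) fun b => seq (push (k + 2) b) (c (k + 2))) σ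
        (v.length * (Q.eval (T + 1) + 3) + 1)
        (update (update σ (k + 1) []) (k + 2)
          (v.foldl (fun acc b => step (b :: acc)) (σ (k + 2)))) := by
    induction v generalizing σ with
    | nil =>
      refine ((Runs.loop_nil hv).of_eq ?_).mono (by simp)
      ext1 m
      simp only [Function.update_apply]
      split_ifs <;> simp_all
    | cons b v ih =>
      have r1 := Runs.push (g := g) (k + 2) b (update σ (k + 1) v)
      have r2 : Runs g (c (k + 2)) _ _
          (update (update σ (k + 1) v) (k + 2) (step (b :: σ (k + 2)))) :=
        (hc (k + 2) (update (update σ (k + 1) v) (k + 2) (b :: update σ (k + 1) v (k + 2)))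
          fun m hm => by
            rw [Function.update_of_ne hm.ne', Function.update_of_ne (by omega), hσ m hm]).of_eq
          (by simp)
      have r3 := ih (update (update σ (k + 1) v) (k + 2) (step (b :: σ (k + 2))))
        (fun m hm => by
          rw [Function.update_of_ne hm.ne', Function.update_of_ne (by omega), hσ m hm])
        (by simp) (fun u hu => by
          simpa using hT (b :: u) (by simpa using hu))
      refine ((Runs.loop_cons hv (r1.seq r2) r3).of_eq ?_).mono ?_
      · ext1 m
        simp only [Function.update_apply]
        split_ifs <;> simp_all
      · have h0 := hT [] (by simp)
        have := eval_mono Q (show (σ (k + 2)).length + 1 ≤ T + 1 by simpa using h0)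
        simp only [Function.update_self, List.length_cons, Nat.succ_mul]
        simp only [ne_eq, Nat.add_left_cancel_iff, OfNat.ofNat_ne_one, not_false_eq_true,
          Function.update_of_ne]
        omega
  refine ⟨fun k => seq (copy k (k + 1) (k + 2)) <| seq (d (k + 1)) <|
    seq (copy k (k + 2) (k + 3)) <| seq (e (k + 2)) <| seq (clear k) <|
    seq (loop (k + 1) fun b => seq (push (k + 2) b) (c (k + 2))) <| move (k + 2) k (k + 3),
    7 * Polynomial.X + 2 + (R + (7 * Polynomial.X + 2 + (S + (2 * Polynomial.X + 1 +
      ((Polynomial.X + R) * (Q.comp (B + 1) + 3) + 1 + (6 * B + 2)))))), fun k σ hσ => ?_⟩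
  have e1 : σ (k + 1) = [] := hσ _ (by omega)
  have e2 : σ (k + 2) = [] := hσ _ (by omega)
  have e3 : σ (k + 3) = [] := hσ _ (by omega)
  have hll := length_le hd (σ k)
  have r1 : Runs g (copy k (k + 1) (k + 2)) σ _ (update σ (k + 1) (σ k)) :=
    (Runs.copy (by omega) (by omega) (by omega) e2).of_eq (by rw [e1, List.append_nil])
  have r2 : Runs g (d (k + 1)) _ _ (update σ (k + 1) (l (σ k))) :=
    (hd (k + 1) (update σ (k + 1) (σ k)) fun m hm => by
      rw [Function.update_of_ne hm.ne', hσ m (by omega)]).of_eq (by simp)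
  have r3 : Runs g (copy k (k + 2) (k + 3)) (update σ (k + 1) (l (σ k))) _
      (update (update σ (k + 1) (l (σ k))) (k + 2) (σ k)) :=
    (Runs.copy (by omega) (by omega) (by omega) (by simp [e3])).of_eq (by simp [e2])
  have r4 : Runs g (e (k + 2)) _ _ (update (update σ (k + 1) (l (σ k))) (k + 2) (i (σ k))) :=
    (he (k + 2) (update (update σ (k + 1) (l (σ k))) (k + 2) (σ k)) fun m hm => by
      rw [Function.update_of_ne hm.ne', Function.update_of_ne (by omega),
        hσ m (by omega)]).of_eq (by simp)
  have r5 : Runs g (clear k) _ _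
      (update (update (update σ (k + 1) (l (σ k))) (k + 2) (i (σ k))) k []) := Runs.clear _ _
  have r6 := hloop k (B.eval (σ k).length) (l (σ k))
    (update (update (update σ (k + 1) (l (σ k))) (k + 2) (i (σ k))) k [])
    (fun m hm => by
      rw [Function.update_of_ne (by omega), Function.update_of_ne (by omega),
        Function.update_of_ne (by omega), hσ m (by omega)])
    (by simp) (fun u hu => by simpa using hB _ u hu)
  have r7 := Runs.move (g := g) (i := k + 2) (j := k) (s := k + 3) (by omega) (by omega) (by omega)
    (σ := update (update (update (update (update σ (k + 1) (l (σ k))) (k + 2) (i (σ k))) k [])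
      (k + 1) []) (k + 2) ((l (σ k)).foldl (fun acc b => step (b :: acc))
        (update (update (update σ (k + 1) (l (σ k))) (k + 2) (i (σ k))) k [] (k + 2))))
    (by simp [e3])
  refine ((r1.seq <| r2.seq <| r3.seq <| r4.seq <| r5.seq <| r6.seq r7).of_eq ?_).mono ?_
  · ext1 m
    simp only [Function.update_apply]
    split_ifs <;> first | omega | rfl | exact List.append_nil _ | rw [hσ m (by omega)]
  · have hBl := hB (σ k) _ (List.prefix_refl _)
    have hm := Nat.mul_le_mul_right (Q.eval (B.eval (σ k).length + 1) + 3) hll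
    simp
    omega

end InPlace

/-! ### A library of polynomial-time functions -/

/-- Replace the first `n` bits by their value under `φ`. -/
def rewriteHead (n : ℕ) (φ : Str → Str) (x : Str) : Str := φ (x.take n) ++ x.drop n

namespace InPlace

theorem exists_length_le {f : Str → Str} (hf : InPlace g f) :
    ∃ Q : Polynomial ℕ, ∀ x, (f x).length ≤ Q.eval x.length := by
  obtain ⟨c, Q, h⟩ := hf
  exact ⟨Polynomial.X + Q, fun x => by simpa using length_le h x⟩

theorem tail : InPlace g List.tail := by
  convert cases (fe := []) (fun _ => InPlace.id (g := g)) using 2 with x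
  cases x <;> rfl

/-- Every function of the first `n` bits is computable. -/
theorem table (n : ℕ) (φ : Str → Str) : InPlace g fun x => φ (x.take n) := by
  induction n generalizing φ with
  | zero => simpa using const (φ [])
  | succ n ih =>
    convert cases (fe := φ []) (fun b => ih fun v => φ (b :: v)) using 2 with x
    cases x <;> simp

theorem rewriteHead (n : ℕ) (φ : Str → Str) : InPlace g (rewriteHead n φ) := by
  change InPlace g fun x => φ (x.take n) ++ x.drop n
  induction n generalizing φ with
  | zero => simpa using append_const (φ [])
  | succ n ih =>
    convert cases (fe := φ []) (fun b => ih fun v => φ (b :: v)) using 2 with x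
    cases x <;> simp

/-- A step that adds at most a constant length keeps all intermediate results polynomial; for an
arbitrary polynomial-time step they could explode. -/
theorem foldl_of_length_le {step l i : Str → Str} (hs : InPlace g step) (hl : InPlace g l)
    (hi : InPlace g i) (c : ℕ) (hc : ∀ b acc, (step (b :: acc)).length ≤ acc.length + c) :
    InPlace g fun x => (l x).foldl (fun acc b => step (b :: acc)) (i x) := by
  obtain ⟨Q, hQ⟩ := hl.exists_length_le
  obtain ⟨R, hR⟩ := hi.exists_length_le
  have key (v acc : Str) :
      (v.foldl (fun acc b => step (b :: acc)) acc).length ≤ acc.length + c * v.length := by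
    induction v generalizing acc with
    | nil => simp
    | cons b v ih =>
      refine (ih _).trans ?_
      have := hc b acc
      dsimp only
      rw [List.length_cons, mul_add]
      omega
  refine foldl hs hl hi (R + Polynomial.C c * Q) fun x v hv => (key v _).trans ?_
  simp only [Polynomial.eval_add, Polynomial.eval_mul, Polynomial.eval_C]
  exact add_le_add (hR x) (Nat.mul_le_mul_left _ (hv.length_le.trans (hQ x)))

theorem reverse : InPlace g List.reverse := by
  convert foldl_of_length_le (step := fun x => x) (l := fun x => x) (i := fun _ => []) .id .id
    (const []) 1 (by simp) using 2 with x
  simp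

/-- Branching on a predicate. -/
theorem cond {q : Str → Bool} {f h : Str → Str} (hq : InPlace g fun x => [q x])
    (hf : InPlace g f) (hh : InPlace g h) : InPlace g fun x => bif q x then f x else h x := by
  have h1 (b : Bool) : InPlace g fun y => bif b then f y.tail else h y.tail := by
    cases b
    · exact hh.comp tail
    · exact hf.comp tail
  exact ((cases (fe := []) h1).comp tail).comp (hq.pair .id)

theorem map_apply {qs : List (Str → Bool)} (h : ∀ q ∈ qs, InPlace g fun x => [q x]) :
    InPlace g fun x => qs.map fun q => q x := by
  induction qs with
  | nil => exact const []
  | cons q qs ih =>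
    have ih := ih fun q hq => h q (List.mem_cons_of_mem _ hq)
    convert cond (h q List.mem_cons_self) ((append_const [true]).comp ih)
      ((append_const [false]).comp ih) using 2 with x
    rw [List.map_cons]
    cases q x <;> rfl

end InPlace

/-! ### Unpairing -/

/-- The state of the automaton is held in two bits: `00` if a marker is expected, `01` if a bit of
the first component is expected, `11` in the second component. -/
def unpairTable (second : Bool) : Str → Str
  | [true, false, false] => [false, true]
  | [false, false, false] => [true, true]
  | [b, false, true] => bif second then [false, false] else [false, false, b]
  | [b, true, c] => bif second then [true, c, b] else [true, c]
  | _ => []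

def unpair (second : Bool) (x : Str) : Str :=
  ((x.foldl (fun acc b => rewriteHead 3 (unpairTable second) (b :: acc))
    [false, false]).tail.tail).reverse

/-- The first component of a pair. -/
def fst : Str → Str := unpair false

/-- The second component of a pair. -/
def snd : Str → Str := unpair true

theorem length_unpairTable_le (second : Bool) (v : Str) :
    (unpairTable second v).length ≤ v.length := by
  unfold unpairTable
  split <;> cases second <;> simp

theorem InPlace.unpair (second : Bool) : InPlace g (unpair second) := by
  refine reverse.comp (tail.comp (tail.comp (foldl_of_length_le
    (rewriteHead 3 (unpairTable second)) .id (const [false, false]) 1 fun b acc => ?_)))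
  have := length_unpairTable_le second ((b :: acc).take 3)
  simp only [SelDim.rewriteHead, List.length_append, List.length_take, List.length_drop, List.length_cons] at this ⊢
  omega

theorem InPlace.fst : InPlace g fst := .unpair false

theorem InPlace.snd : InPlace g snd := .unpair true

theorem foldl_unpair_second (second c : Bool) (o b : Str) :
    b.foldl (fun acc b => rewriteHead 3 (unpairTable second) (b :: acc))
      (true :: c :: o) = true :: c :: bif second then b.reverse ++ o else o := by
  induction b generalizing o with
  | nil => simp
  | cons x b ih =>
    rw [List.foldl_cons, show rewriteHead 3 (unpairTable second) (x :: true :: c :: o) =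
      true :: c :: bif second then x :: o else o by cases second <;> cases x <;> cases c <;> rfl, ih]
    cases second <;> simp

/-- The bits of the selected component are pushed below the two state bits, hence appear in reverse
order. -/
theorem foldl_unpair (second : Bool) (o a b : Str) :
    (pair a b).foldl (fun acc b => rewriteHead 3 (unpairTable second) (b :: acc))
      (false :: false :: o) =
      true :: true :: bif second then b.reverse ++ o else a.reverse ++ o := by
  induction a generalizing o with
  | nil =>
    rw [show pair [] b = false :: b from rfl, List.foldl_cons,
      show rewriteHead 3 (unpairTable second) (false :: false :: false :: o) = true :: true :: o from
        rfl, foldl_unpair_second]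
    rfl
  | cons x a ih =>
    rw [show pair (x :: a) b = true :: x :: pair a b by simp [pair]]
    rw [List.foldl_cons, List.foldl_cons,
      show rewriteHead 3 (unpairTable second) (true :: false :: false :: o) = false :: true :: o from
        rfl,
      show rewriteHead 3 (unpairTable second) (x :: false :: true :: o) =
        false :: false :: bif second then o else x :: o by cases second <;> cases x <;> rfl, ih]
    cases second <;> simp

@[simp] theorem fst_pair (a b : Str) : fst (pair a b) = a := by
  simp [fst, unpair, foldl_unpair]

@[simp] theorem snd_pair (a b : Str) : snd (pair a b) = b := by
  simp [snd, unpair, foldl_unpair]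

theorem length_pair (a b : Str) : (pair a b).length = 2 * a.length + b.length + 1 := by
  simp [pair]; ring

/-! ### Equality of strings -/

/-- The arguments are the bit just read, a flag that is true while no difference has been found, and
the next bit of the other string. An exhausted other string counts as a difference. -/
def eqTable : Str → Str
  | [b, true, c] => [b == c]
  | [_, true] => [false]
  | [_, false, _] => [false]
  | [_, false] => [false]
  | _ => []

theorem length_eqTable_le (v : Str) : (eqTable v).length ≤ v.length := by
  unfold eqTable
  split <;> simp

theorem foldl_eqTable_false (a b : Str) :
    (a.foldl (fun acc b => rewriteHead 3 eqTable (b :: acc))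
      (false :: b)).take 1 = [false] := by
  induction a generalizing b with
  | nil => simp
  | cons x a ih => rcases b with _ | ⟨c, b⟩ <;> simp only [List.foldl_cons] <;> apply ih

theorem foldl_eqTable_true (a b : Str) :
    (a.foldl (fun acc b => rewriteHead 3 eqTable (b :: acc))
      (true :: b)) = [true] ↔ a = b := by
  induction a generalizing b with
  | nil => cases b <;> simp
  | cons x a ih =>
    rcases b with _ | ⟨c, b⟩
    · rw [List.foldl_cons, show rewriteHead 3 eqTable [x, true] = [false] from rfl]
      refine iff_of_false (fun h => ?_) (by simp)
      have := foldl_eqTable_false a []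
      simp [h] at this
    · rw [List.foldl_cons, show rewriteHead 3 eqTable (x :: true :: c :: b) = (x == c) :: b from rfl,
        List.cons.injEq]
      by_cases hxc : x = c
      · simpa [hxc] using ih b
      · refine iff_of_false (fun h => ?_) (by simp [hxc])
        have := foldl_eqTable_false a b
        rw [beq_eq_false_iff_ne.2 hxc] at h
        simp [h] at this

theorem InPlace.eq {f h : Str → Str} (hf : InPlace g f) (hh : InPlace g h) :
    InPlace g fun x => [decide (f x = h x)] := by
  have h1 : InPlace g fun x => (f x).foldl
      (fun acc b => SelDim.rewriteHead 3 eqTable (b :: acc)) (true :: h x) := by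
    refine foldl_of_length_le (rewriteHead 3 eqTable) hf ((append_const [true]).comp hh) 1
      fun b acc => ?_
    have := length_eqTable_le ((b :: acc).take 3)
    simp only [SelDim.rewriteHead, List.length_append, List.length_take, List.length_drop, List.length_cons] at this ⊢
    omega
  -- Equality means that the flag survived and nothing of the other string is left; two bits suffice
  -- to see this.
  convert (table 2 fun v => [decide (v = [true])]).comp h1 using 3 with x
  rw [decide_eq_decide, ← foldl_eqTable_true]
  generalize (f x).foldl _ _ = y
  rcases y with _ | ⟨a, _ | ⟨b, y⟩⟩ <;> simp

/-! ### Arithmetic in binary -/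

/-- The binary numeral of `C * x + c`, from that of `x`. -/
def affine (C : ℕ) : ℕ → Str → Str
  | c, [] => c.bits
  | c, b :: x => (c + C * b.toNat).bodd :: affine C ((c + C * b.toNat) / 2) x

theorem bits_eq_bodd_cons {n : ℕ} (hn : n ≠ 0) : n.bits = n.bodd :: (n / 2).bits := by
  conv_lhs => rw [← Nat.bit_bodd_div2 n]
  rw [Nat.bits_append_bit, Nat.div2_val]
  intro h
  by_contra hb
  apply hn
  rw [← Nat.bit_bodd_div2 n, h]
  simp at hb
  simp [hb]

theorem affine_bits {C : ℕ} (hC : 0 < C) (c x : ℕ) : affine C c x.bits = (C * x + c).bits := by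
  induction x using Nat.strong_induction_on generalizing c with
  | _ x ih =>
    rcases eq_or_ne x 0 with rfl | hx
    · simp [affine]
    · have hm : C * x + c ≠ 0 := by positivity
      have hx2 : x = 2 * (x / 2) + x.bodd.toNat := by
        have := Nat.bodd_add_div2 x
        rw [Nat.div2_val] at this
        omega
      have e : C * x + c = 2 * (C * (x / 2)) + (c + C * x.bodd.toNat) := by
        conv_lhs => rw [hx2]
        ring
      rw [bits_eq_bodd_cons hx, bits_eq_bodd_cons hm, affine, ih _ (by omega), e]
      simp [Nat.bodd_add, Nat.bodd_mul, Nat.mul_add_div]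

/-- The carry in unary, padded to the fixed width `K` so that a finite table can update it at the
head of the accumulator. -/
def carryCode (K n : ℕ) : Str := (List.replicate n true ++ List.replicate K false).take K

theorem length_carryCode (K n : ℕ) : (carryCode K n).length = K := by
  simp [carryCode]

theorem count_carryCode {K n : ℕ} (h : n ≤ K) : (carryCode K n).count true = n := by
  rw [carryCode, List.take_append, List.take_of_length_le (by simpa), List.count_append]
  simp [List.count_replicate]

def affineTable (C K : ℕ) (v : Str) : Str :=
  let s := v.tail.count true + C * (v.headD false).toNat
  carryCode K (s / 2) ++ [s.bodd]

/-- A carry `c ≤ K` is followed by at most `(c + C) / 2 ≤ K`, so it never outgrows its field. The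
invariant is that the digits written so far, followed by the digits still to come, do not change. -/
theorem foldl_affineTable {C K : ℕ} (hK : C ≤ K) (x o : Str) {c : ℕ} (hc : c ≤ K) :
    ∃ c' ≤ K, ∃ o' : Str,
      x.foldl (fun acc b => rewriteHead (K + 1) (affineTable C K) (b :: acc))
        (carryCode K c ++ o) = carryCode K c' ++ o' ∧
      o'.reverse ++ c'.bits = o.reverse ++ affine C c x := by
  induction x generalizing c o with
  | nil => exact ⟨c, hc, o, rfl, rfl⟩
  | cons b x ih =>
    have hC : C * b.toNat ≤ C := by cases b <;> simp
    obtain ⟨c', hc', o', h1, h2⟩ := ih ((c + C * b.toNat).bodd :: o)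
      (c := (c + C * b.toNat) / 2) (by omega)
    refine ⟨c', hc', o', ?_, ?_⟩
    · rw [← h1, List.foldl_cons]
      congr 1
      simp [rewriteHead, affineTable, length_carryCode, count_carryCode hc]
    · rw [h2, affine]
      simp

theorem InPlace.affine (C c : ℕ) : InPlace g (affine C c) := by
  -- The field must hold the initial carry `c` as well as the later ones.
  set K := max C c
  have h1 : InPlace g fun x : Str => x.foldl (fun acc b =>
      SelDim.rewriteHead (K + 1) (affineTable C K) (b :: acc)) (carryCode K c) := by
    refine foldl_of_length_le (rewriteHead (K + 1) (affineTable C K)) .id (const _) (K + 1)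
      fun b acc => ?_
    simp [SelDim.rewriteHead, affineTable, length_carryCode]
    omega
  convert reverse.comp ((rewriteHead K fun v => (v.count true).bits.reverse).comp h1)
    using 2 with x
  obtain ⟨c', hc', o', h1, h2⟩ := foldl_affineTable (le_max_left C c) x [] (le_max_right C c)
  simp only [List.append_nil] at h1
  rw [h1]
  simp only [List.reverse_nil, List.nil_append] at h2
  rw [← h2]
  simp [SelDim.rewriteHead, length_carryCode, count_carryCode hc', K]

/-! ### Prediction by majority among the cuts of a tournament -/

/-- The subsets of `{0, …, N - 1}` compatible with the tournament `R`, where `R a b` says that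
`a` belongs to the set if `b` does. -/
def cuts (N : ℕ) (R : ℕ → ℕ → Bool) : Finset (Finset (Fin N)) :=
  {S | ∀ a b : Fin N, (R a b = true → b ∈ S → a ∈ S) ∧ (R a b = false → a ∈ S → b ∈ S)}

/-- Two incomparable cuts would contain some `a` and some `b` respectively that the other lacks, and
either value of `R a b` excludes this. So the cuts form a chain, and a member is determined by its
cardinality. -/
theorem card_cuts_le (N : ℕ) (R : ℕ → ℕ → Bool) : (cuts N R).card ≤ N + 1 := by
  rw [← Finset.card_range (N + 1)]
  refine Finset.card_le_card_of_injOn Finset.card (fun S _ => ?_) fun S hS S' hS' h => ?_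
  · simpa [Nat.lt_succ_iff] using Finset.card_le_univ S
  · simp only [cuts, Finset.coe_filter, Finset.mem_univ, true_and, Set.mem_ofPred_eq] at hS hS'
    by_cases hsub : S ⊆ S'
    · exact Finset.eq_of_subset_of_card_le hsub h.ge
    by_cases hsub' : S' ⊆ S
    · exact (Finset.eq_of_subset_of_card_le hsub' h.le).symm
    obtain ⟨a, ha, ha'⟩ := Finset.not_subset.1 hsub
    obtain ⟨b, hb, hb'⟩ := Finset.not_subset.1 hsub'
    cases hR : R a b
    · exact absurd ((hS a b).2 hR ha) hb'
    · exact absurd ((hS' a b).1 hR hb) ha'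

/-- The cuts whose characteristic sequence starts with `u`. -/
def cutsExtending (N : ℕ) (R : ℕ → ℕ → Bool) (u : Str) : Finset (Finset (Fin N)) :=
  {S ∈ cuts N R | ∀ i : Fin N, (i : ℕ) < u.length → (u.getD i false = true ↔ i ∈ S)}

theorem cutsExtending_concat {N : ℕ} (R : ℕ → ℕ → Bool) {u : Str} (hu : u.length < N) (b : Bool) :
    cutsExtending N R (u ++ [b]) =
      {S ∈ cutsExtending N R u | decide ((⟨u.length, hu⟩ : Fin N) ∈ S) = b} := by
  ext S
  simp only [cutsExtending, Finset.mem_filter, and_assoc, and_congr_right_iff,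
    List.length_append, List.length_singleton]
  intro _
  constructor
  · refine fun h => ⟨fun i hi => ?_, ?_⟩
    · rw [← h i (by omega), List.getD_append _ _ _ _ hi]
    · have := h ⟨u.length, hu⟩ (by simp)
      rw [List.getD_append_right _ _ _ _ (by simp)] at this
      simp only [Nat.sub_self, List.getD_cons_zero] at this
      cases b <;> simp_all
  · rintro ⟨h, hb⟩ i hi
    rcases Nat.lt_succ_iff_lt_or_eq.1 hi with hi | hi
    · rw [List.getD_append _ _ _ _ hi, h i hi]
    · obtain rfl : i = ⟨u.length, hu⟩ := Fin.ext hi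
      rw [List.getD_append_right _ _ _ _ (by simp)]
      simp [← hb]

theorem card_cutsExtending {N : ℕ} (R : ℕ → ℕ → Bool) {u : Str} (hu : u.length < N) :
    (cutsExtending N R u).card =
      (cutsExtending N R (u ++ [false])).card + (cutsExtending N R (u ++ [true])).card := by
  rw [cutsExtending_concat R hu, cutsExtending_concat R hu, add_comm]
  simp only [decide_eq_true_eq, decide_eq_false_iff_not]
  exact (Finset.card_filter_add_card_filter_not _).symm

/-- The next bit of the majority of the cuts extending `u`. -/
def majority (N : ℕ) (R : ℕ → ℕ → Bool) (u : Str) : Bool :=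
  decide ((cutsExtending N R (u ++ [false])).card ≤ (cutsExtending N R (u ++ [true])).card)

/-! ### Mistake bounds -/

/-- The number of bits of `v` that `π` predicts correctly, after `u`. -/
def hits (π : Str → Bool) : Str → Str → ℕ
  | _, [] => 0
  | u, b :: v => (if π u = b then 1 else 0) + hits π (u ++ [b]) v

/-- The number of bits of `v` that `π` predicts wrongly, after `u`. -/
def misses (π : Str → Bool) : Str → Str → ℕ
  | _, [] => 0
  | u, b :: v => (if π u = b then 0 else 1) + misses π (u ++ [b]) v

theorem hits_add_misses (π : Str → Bool) (u v : Str) : hits π u v + misses π u v = v.length := by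
  induction v generalizing u with
  | nil => rfl
  | cons b v ih =>
    have := ih (u ++ [b])
    simp only [hits, misses, List.length_cons]
    split_ifs <;> omega

theorem hits_append (π : Str → Bool) (u v v' : Str) :
    hits π u (v ++ v') = hits π u v + hits π (u ++ v) v' := by
  induction v generalizing u with
  | nil => simp [hits]
  | cons b v ih => simp [hits, ih, add_assoc]

theorem misses_append (π : Str → Bool) (u v v' : Str) :
    misses π u (v ++ v') = misses π u v + misses π (u ++ v) v' := by
  induction v generalizing u with
  | nil => simp [misses]
  | cons b v ih => simp [misses, ih, add_assoc]

theorem hits_concat (π : Str → Bool) (w : Str) (b : Bool) :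
    hits π [] (w ++ [b]) = hits π [] w + if π w = b then 1 else 0 := by
  simp [hits_append, hits]

/-- After a wrong prediction the surviving cuts are those on the minority side, at most half of the
previous ones; a right prediction cannot increase their number. -/
theorem two_pow_misses_majority {N : ℕ} (R : ℕ → ℕ → Bool) (u v : Str)
    (h : u.length + v.length ≤ N) :
    2 ^ misses (majority N R) u v * (cutsExtending N R (u ++ v)).card ≤
      (cutsExtending N R u).card := by
  induction v generalizing u with
  | nil => simp [misses]
  | cons b v ih =>
    rw [List.length_cons] at h
    have ih := ih (u ++ [b]) (by simp; omega)
    rw [List.append_assoc, List.singleton_append] at ih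
    have hc := card_cutsExtending R (u := u) (N := N) (by omega)
    rw [misses]
    split_ifs with hb
    · rw [zero_add]
      refine ih.trans ?_
      cases b <;> omega
    · rw [pow_add, pow_one, mul_assoc]
      refine (Nat.mul_le_mul_left 2 ih).trans ?_
      cases b <;> simp [majority] at hb <;> omega

/-- Majority prediction in consecutive blocks of length `N`. -/
def blockPredictor (N : ℕ) (R : ℕ → ℕ → Bool) (w : Str) : Bool :=
  majority N (fun a b => R (N * (w.length / N) + a) (N * (w.length / N) + b))
    (w.drop (N * (w.length / N)))

theorem misses_blockPredictor {N : ℕ} (R : ℕ → ℕ → Bool) {w : Str} {j : ℕ}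
    (hw : w.length = N * j) (u v : Str) (h : u.length + v.length ≤ N) :
    misses (blockPredictor N R) (w ++ u) v =
      misses (majority N fun a b => R (N * j + a) (N * j + b)) u v := by
  induction v generalizing u with
  | nil => rfl
  | cons b v ih =>
    rw [List.length_cons] at h
    have hdiv : (w ++ u).length / N = j := by
      rw [List.length_append, hw, Nat.mul_add_div (by omega), Nat.div_eq_of_lt (by omega), add_zero]
    have hpred : blockPredictor N R (w ++ u) =
        majority N (fun a b => R (N * j + a) (N * j + b)) u := by
      rw [blockPredictor, hdiv, ← hw, List.drop_left]
    rw [misses, misses, hpred, List.append_assoc, ih (u ++ [b]) (by simp; omega)]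

theorem length_charPrefix (A : Set Str) (n : ℕ) : (charPrefix A n).length = n := by
  simp [charPrefix]

/-- The restriction of `A` to a block is itself a cut and is never eliminated, so at least one cut
survives the block. Each block thus contributes a factor of at most `N + 1`. -/
theorem two_pow_misses_charPrefix {N : ℕ} {R : ℕ → ℕ → Bool} {A : Set Str}
    (hR : ∀ m n, (R m n = true → stdString n ∈ A → stdString m ∈ A) ∧
      (R m n = false → stdString m ∈ A → stdString n ∈ A)) (j : ℕ) :
    2 ^ misses (blockPredictor N R) [] (charPrefix A (N * j)) ≤ (N + 1) ^ j := by
  classical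
  induction j with
  | zero => simp [charPrefix, misses]
  | succ j ih =>
    set v : Str := (List.range N).map fun i => decide (stdString (N * j + i) ∈ A) with hv
    have hvl : v.length = N := by simp [hv]
    have hpre : charPrefix A (N * (j + 1)) = charPrefix A (N * j) ++ v := by
      simp only [charPrefix, mul_add, mul_one, List.range_add, List.map_append, List.map_map, hv]
      congr
    have hb := misses_blockPredictor R (length_charPrefix A (N * j)) [] v (by simp [hvl])
    rw [List.append_nil] at hb
    rw [hpre, misses_append, List.nil_append, hb, pow_add, pow_succ (N + 1)]
    refine Nat.mul_le_mul ih ?_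
    have h1 := two_pow_misses_majority (N := N) (fun a b => R (N * j + a) (N * j + b)) [] v
      (by simp [hvl])
    have h2 : 0 < (cutsExtending N (fun a b => R (N * j + a) (N * j + b)) ([] ++ v)).card := by
      rw [Finset.card_pos]
      refine ⟨Finset.univ.filter fun i : Fin N => stdString (N * j + i) ∈ A, ?_⟩
      simp only [cutsExtending, cuts, Finset.mem_filter, Finset.mem_univ, true_and]
      refine ⟨fun a b => hR _ _, fun i _ => ?_⟩
      simp [hv]
    have h3 : (cutsExtending N (fun a b => R (N * j + a) (N * j + b)) []).card ≤ N + 1 :=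
      (Finset.card_le_card (Finset.filter_subset _ _)).trans (card_cuts_le _ _)
    exact (Nat.le_mul_of_pos_right _ h2).trans (h1.trans h3)

/-! ### The gale of a predictor -/

/-- The capital obtained by betting on the predictions of `π`: it is multiplied by `(D + 1) / D`
for a correct prediction, and by `1 / D` for a wrong one. -/
noncomputable def predictorGale (π : Str → Bool) (D : ℕ) (w : Str) : ℝ≥0 :=
  ((D + 1) ^ hits π [] w : ℕ) / (D ^ w.length : ℕ)

/-- The factors of the two outcomes add up to `(D + 2) / D`, which the choice of `s` compensates. -/
theorem isGale_predictorGale (π : Str → Bool) {D : ℕ} (hD : 0 < D) {s : ℝ≥0}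
    (hs : (2 : ℝ) ^ (s : ℝ) = 1 + 2 / D) : IsGale s (predictorGale π D) := by
  intro w
  have hD' : (D : ℝ) ≠ 0 := by positivity
  rw [← NNReal.coe_inj]
  push_cast
  rw [Real.rpow_neg (by norm_num), hs]
  simp only [predictorGale, hits_concat, List.length_append, List.length_singleton]
  push_cast
  cases π w <;> simp <;> field_simp <;> ring

/-- After `j` blocks the capital is `(1 + 1 / 2 ^ k) ^ (N * j)` divided by `2 ^ k + 1` once per
mistake. As `2 ^ k + 1 ≤ 2 ^ (k + 1)`, the mistake bound limits this divisor to `((N + 1) ^ (k + 1))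
^ j`, and the capital at block ends is at least a power `ρ ^ j` with `ρ > 1`. -/
theorem succeeds_predictorGale {k N : ℕ} {R : ℕ → ℕ → Bool} {A : Set Str}
    (hR : ∀ m n, (R m n = true → stdString n ∈ A → stdString m ∈ A) ∧
      (R m n = false → stdString m ∈ A → stdString n ∈ A))
    (hN : ((N : ℝ) + 1) ^ (k + 1) < (1 + 1 / 2 ^ k) ^ N) :
    Succeeds (predictorGale (blockPredictor N R) (2 ^ k)) A := by
  set ρ : ℝ≥0 := (1 + 1 / 2 ^ k) ^ N / ((N : ℝ≥0) + 1) ^ (k + 1) with hρ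
  have hρ1 : 1 < ρ := by
    rw [hρ, one_lt_div (by positivity), ← NNReal.coe_lt_coe]
    push_cast
    exact hN
  have hN0 : 0 < N := by
    rcases Nat.eq_zero_or_pos N with rfl | h
    · simp at hN
    · exact h
  have key (j : ℕ) :
      ρ ^ j ≤ predictorGale (blockPredictor N R) (2 ^ k) (charPrefix A (N * j)) := by
    have hm := two_pow_misses_charPrefix (N := N) hR j
    have hh := hits_add_misses (blockPredictor N R) [] (charPrefix A (N * j))
    rw [length_charPrefix] at hh
    rw [predictorGale, length_charPrefix]
    set a := hits (blockPredictor N R) [] (charPrefix A (N * j))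
    set e := misses (blockPredictor N R) [] (charPrefix A (N * j))
    have h1 : (2 ^ k + 1) ^ e ≤ ((N + 1) ^ (k + 1)) ^ j :=
      calc (2 ^ k + 1) ^ e ≤ (2 ^ (k + 1)) ^ e := by
            refine Nat.pow_le_pow_left ?_ _
            have := Nat.one_le_two_pow (n := k)
            rw [pow_succ]; omega
        _ = (2 ^ e) ^ (k + 1) := by rw [← pow_mul, ← pow_mul, mul_comm]
        _ ≤ ((N + 1) ^ j) ^ (k + 1) := Nat.pow_le_pow_left hm _
        _ = _ := by rw [← pow_mul, ← pow_mul, mul_comm]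
    have h2 : (2 ^ k + 1) ^ (N * j) ≤ (2 ^ k + 1) ^ a * ((N + 1) ^ (k + 1)) ^ j := by
      rw [← hh, pow_add]
      exact Nat.mul_le_mul_left _ h1
    have h3 : (((2 ^ k + 1) ^ (N * j) : ℕ) : ℝ≥0) ≤
        ((2 ^ k + 1) ^ a * ((N + 1) ^ (k + 1)) ^ j : ℕ) := by exact_mod_cast h2
    rw [hρ, div_pow, ← pow_mul, div_le_div_iff₀ (by positivity) (by positivity)]
    push_cast at h3 ⊢
    refine le_trans (le_of_eq ?_) h3
    rw [← mul_pow]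
    congr 1
    field_simp
  refine ENNReal.eq_top_of_forall_nnreal_le fun M => ?_
  obtain ⟨j₀, hj₀⟩ := pow_unbounded_of_one_lt (M + 1) hρ1
  refine le_trans (b := ((M + 1 : ℝ≥0) : ℝ≥0∞)) (by exact_mod_cast (lt_add_one M).le)
    (Filter.le_limsup_of_frequently_le ?_)
  rw [Filter.frequently_atTop]
  intro n
  refine ⟨N * (n + j₀), (Nat.le_add_right n j₀).trans (Nat.le_mul_of_pos_left _ hN0), ?_⟩
  exact_mod_cast (hj₀.le.trans (pow_le_pow_right₀ hρ1.le (Nat.le_add_left j₀ n))).trans (key _)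

theorem exists_block_length (k : ℕ) :
    ∃ N : ℕ, ((N : ℝ) + 1) ^ (k + 1) < (1 + 1 / 2 ^ k) ^ N := by
  set r : ℝ := 1 + 1 / 2 ^ k with hr
  have hr1 : 1 < r := by simp [hr]
  -- An exponential beats a power. The limit is used at `N + 1`, and the comparison with `1 / r`
  -- absorbs the extra factor `r`.
  have h := (tendsto_pow_const_div_const_pow_of_one_lt (k + 1) hr1).comp
    (Filter.tendsto_add_atTop_nat 1)
  have h2 := (h.eventually (gt_mem_nhds (show (0 : ℝ) < 1 / r by positivity))).exists
  obtain ⟨N, hN⟩ := h2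
  refine ⟨N, ?_⟩
  simp only [Function.comp] at hN
  rw [div_lt_div_iff₀ (by positivity) (by positivity), pow_succ, one_mul] at hN
  push_cast at hN
  exact lt_of_mul_lt_mul_right hN (by positivity)

/-! ### Computing the gale -/

/-- The `(m + a)`-th string, from the binary numeral of `m + 1`. -/
def stringAt (a : ℕ) (M : Str) : Str := (affine 1 a M).reverse.tail

theorem stringAt_bits (a m : ℕ) : stringAt a (m + 1).bits = stdString (m + a) := by
  rw [stringAt, affine_bits one_pos, stdString, List.tail_reverse,
    show 1 * (m + 1) + a = m + a + 1 by ring]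

theorem InPlace.stringAt (a : ℕ) : InPlace g (stringAt a) :=
  tail.comp (reverse.comp (.affine 1 a))

/-- The `N × N` table of the comparisons `r` between the strings of a block. -/
def blockTable (N : ℕ) (r : Str → Str → Bool) (M : Str) : Str :=
  (List.range (N * N)).map fun i => r (stringAt (i / N) M) (stringAt (i % N) M)

/-- The number of comparisons is a constant. The hypothesis on `r` is stated for computable
arguments `u`, `v`, so that both strings can be derived from the one input `M`. -/
theorem InPlace.blockTable (N : ℕ) {r : Str → Str → Bool}
    (hr : ∀ u v : Str → Str, InPlace g u → InPlace g v → InPlace g fun x => [r (u x) (v x)]) :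
    InPlace g (blockTable N r) := by
  convert map_apply (g := g) (qs := (List.range (N * N)).map
    fun i M => r (SelDim.stringAt (i / N) M) (SelDim.stringAt (i % N) M)) ?_ using 2 with M
  · simp [SelDim.blockTable]
  · intro q hq
    obtain ⟨i, -, rfl⟩ := List.mem_map.1 hq
    exact hr _ _ (.stringAt _) (.stringAt _)

theorem majority_congr {N : ℕ} {R R' : ℕ → ℕ → Bool} (h : ∀ a < N, ∀ b < N, R a b = R' a b)
    (u : Str) : majority N R u = majority N R' u := by
  have : cuts N R = cuts N R' := by
    ext S
    simp only [cuts, Finset.mem_filter, Finset.mem_univ, true_and]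
    exact forall₂_congr fun a b => by rw [h a a.2 b b.2]
  have h2 (v : Str) : cutsExtending N R v = cutsExtending N R' v := by
    ext S
    simp [cutsExtending, this]
  simp only [majority, h2]

theorem getD_blockTable {N a b : ℕ} (ha : a < N) (hb : b < N) (r : Str → Str → Bool) (m : ℕ) :
    (blockTable N r (m + 1).bits).getD (a * N + b) false =
      r (stdString (m + a)) (stdString (m + b)) := by
  have hlt : a * N + b < N * N :=
    calc a * N + b < a * N + N := by omega
      _ = (a + 1) * N := by ring
      _ ≤ N * N := Nat.mul_le_mul_right _ ha
  have h1 : (a * N + b) / N = a := by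
    rw [mul_comm, Nat.mul_add_div (by omega), Nat.div_eq_of_lt hb, add_zero]
  have h2 : (a * N + b) % N = b := by
    rw [mul_comm, Nat.mul_add_mod, Nat.mod_eq_of_lt hb]
  rw [List.getD_eq_getElem _ _ (by simpa [blockTable] using hlt)]
  simp [blockTable, h1, h2, stringAt_bits]

/-- The majority prediction, from the reverse of the current part `u` of the block and the table
of comparisons. -/
def predictTable (N : ℕ) (v : Str) : Bool :=
  majority N (fun a b => (snd v).getD (a * N + b) false) (fst v).reverse

/-- One step of the computation of the gale: the first bit of `y` is the next bit of the sequence,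
the rest consists of the numeral `M` of the beginning of the block, the reverse `u` of the current
part of the block, and the numerator and the denominator of the capital. -/
def galeStep (N D : ℕ) (r : Str → Str → Bool) (y : Str) : Str :=
  let b := y.headD false
  let M := fst y.tail
  let u := fst (snd y.tail)
  let num := fst (snd (snd y.tail))
  let den := snd (snd (snd y.tail))
  -- The truncations make this test and the prediction depend on boundedly many bits, hence
  -- computable by tables. On genuine states they cut off nothing: `u` has fewer than `N` bits, and
  -- the pair has at most `2 * N + N * N + 1`.
  let full := decide ((u.take N).length + 1 = N)
  let hit := predictTable N ((pair u (blockTable N r M)).take (2 * N + N * N + 1)) == b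
  pair (bif full then affine 1 N M else M) <|
    pair (bif full then [] else bif b then true :: u else false :: u) <| pair (bif hit then affine (D + 1) 0 num else num) (affine D 0 den)

theorem InPlace.galeStep (N D : ℕ) {r : Str → Str → Bool}
    (hr : ∀ u v : Str → Str, InPlace g u → InPlace g v → InPlace g fun x => [r (u x) (v x)]) :
    InPlace g (galeStep N D r) := by
  have hb : InPlace g fun y => [y.headD false] := by
    convert table (g := g) 1 fun v => [v.headD false] using 3 with y
    cases y <;> rfl
  have hM : InPlace g fun y => SelDim.fst y.tail := fst.comp tail
  have hs : InPlace g fun y => SelDim.snd y.tail := snd.comp tail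
  have hu := fst.comp hs
  have hn := fst.comp (snd.comp hs)
  have hd := snd.comp (snd.comp hs)
  have hfull := (table (g := g) N fun v => [decide (v.length + 1 = N)]).comp hu
  have hpred := (table (g := g) (2 * N + N * N + 1) fun v => [predictTable N v]).comp
    (hu.pair ((InPlace.blockTable N hr).comp hM))
  have hhit : InPlace g fun y => [predictTable N ((SelDim.pair (SelDim.fst (SelDim.snd y.tail))
      (SelDim.blockTable N r (SelDim.fst y.tail))).take (2 * N + N * N + 1)) == y.headD false] := by
    refine (table (g := g) 2 fun v => [v.getD 0 false == v.getD 1 false]).comp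
      (map_apply (qs := [fun y => predictTable N ((SelDim.pair (SelDim.fst (SelDim.snd y.tail))
      (SelDim.blockTable N r (SelDim.fst y.tail))).take (2 * N + N * N + 1)),
        fun y => y.headD false]) fun q hq => ?_)
    rcases List.mem_pair.1 hq with rfl | rfl
    · exact hpred
    · exact hb
  exact (hfull.cond ((InPlace.affine 1 N).comp hM) hM).pair <|
    (hfull.cond (const []) (hb.cond ((append_const [true]).comp hu)
      ((append_const [false]).comp hu))).pair <|
    (hhit.cond ((InPlace.affine (D + 1) 0).comp hn) hn).pair ((InPlace.affine D 0).comp hd)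

/-- The state of the computation after the bits `w`. -/
def galeState (N D : ℕ) (r : Str → Str → Bool) (w : Str) : Str :=
  pair (N * (w.length / N) + 1).bits <| pair (w.drop (N * (w.length / N))).reverse <|
    pair ((D + 1) ^ hits (blockPredictor N fun m n => r (stdString m) (stdString n)) [] w).bits
      (D ^ w.length).bits

theorem galeStep_cons_pair (N D : ℕ) (r : Str → Str → Bool) (b : Bool) (M u num den : Str) :
    galeStep N D r (b :: pair M (pair u (pair num den))) =
      pair (bif decide ((u.take N).length + 1 = N) then affine 1 N M else M)
        (pair (bif decide ((u.take N).length + 1 = N) then [] else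
            bif b then true :: u else false :: u)
          (pair (bif predictTable N ((pair u (blockTable N r M)).take (2 * N + N * N + 1)) == b
              then affine (D + 1) 0 num else num)
            (affine D 0 den))) := by
  simp only [galeStep, List.headD_cons, List.tail_cons, fst_pair, snd_pair]

theorem succ_div_eq {N n : ℕ} (hN : 0 < N) :
    (n + 1) / N = if n % N + 1 = N then n / N + 1 else n / N := by
  have hmod : N * (n / N) + n % N = n := Nat.div_add_mod _ _
  have hlt : n % N < N := Nat.mod_lt _ hN
  split_ifs with h
  · rw [show n + 1 = N * (n / N + 1) by rw [mul_add]; omega, Nat.mul_div_cancel_left _ hN]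
  · rw [show n + 1 = N * (n / N) + (n % N + 1) by omega, Nat.mul_add_div hN,
      Nat.div_eq_of_lt (show n % N + 1 < N by omega), add_zero]

theorem predictTable_block {N : ℕ} (hN : 0 < N) (r : Str → Str → Bool) (w : Str) :
    predictTable N ((pair (w.drop (N * (w.length / N))).reverse
      (blockTable N r (N * (w.length / N) + 1).bits)).take (2 * N + N * N + 1)) =
      blockPredictor N (fun m n => r (stdString m) (stdString n)) w := by
  have hmod : N * (w.length / N) + w.length % N = w.length := Nat.div_add_mod _ _
  have hlt : w.length % N < N := Nat.mod_lt _ hN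
  rw [List.take_of_length_le, predictTable, blockPredictor, fst_pair, snd_pair,
    List.reverse_reverse]
  · exact majority_congr (fun a ha b hb => getD_blockTable ha hb r _) _
  · rw [length_pair, List.length_reverse, List.length_drop, blockTable, List.length_map,
      List.length_range]
    omega

/-- Correctness of the simulation. When the block is completed, the numeral advances by `N` and the
stored part of the block is emptied; in all cases numerator and denominator follow the bet. -/
theorem galeStep_galeState {N D : ℕ} (hN : 0 < N) (hD : 0 < D) (r : Str → Str → Bool) (w : Str)
    (b : Bool) : galeStep N D r (b :: galeState N D r w) = galeState N D r (w ++ [b]) := by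
  have hmod : N * (w.length / N) + w.length % N = w.length := Nat.div_add_mod _ _
  have hlt : w.length % N < N := Nat.mod_lt _ hN
  have htake : ((w.drop (N * (w.length / N))).reverse.take N).length =
      w.length % N := by
    rw [List.length_take, List.length_reverse, List.length_drop]
    omega
  have hlen : (w ++ [b]).length = w.length + 1 := by simp
  rw [galeState, galeStep_cons_pair, galeState, predictTable_block hN, htake, hlen, succ_div_eq hN,
    affine_bits one_pos, affine_bits D.succ_pos, affine_bits hD]
  refine congrArg₂ pair ?_ (congrArg₂ pair ?_ (congrArg₂ pair ?_ ?_))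
  · by_cases hf : w.length % N + 1 = N
    · simp only [hf, decide_true, cond_true, if_true]
      congr 1
      ring
    · simp only [hf, decide_false, cond_false, if_false]
  · by_cases hf : w.length % N + 1 = N
    · simp only [hf, decide_true, cond_true, if_true]
      rw [List.drop_of_length_le, List.reverse_nil]
      rw [hlen, mul_add]
      omega
    · simp only [hf, decide_false, cond_false, if_false]
      rw [List.drop_append_of_le_length (by omega)]
      cases b <;> simp
  · rw [hits_concat]
    by_cases hp : blockPredictor N (fun m n => r (stdString m) (stdString n)) w = b
    · simp only [hp, beq_self_eq_true, cond_true, if_true]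
      rw [add_zero, pow_succ, mul_comm]
    · rw [if_neg hp, beq_eq_false_iff_ne.2 hp, cond_false, add_zero]
  · rw [add_zero, pow_succ, mul_comm]

theorem foldl_galeStep {N D : ℕ} (hN : 0 < N) (hD : 0 < D) (r : Str → Str → Bool) (w : Str) :
    w.foldl (fun acc b => galeStep N D r (b :: acc)) (galeState N D r []) = galeState N D r w := by
  induction w using List.reverseRecOn with
  | nil => rfl
  | append_singleton w b ih => rw [List.foldl_append, ih, List.foldl_cons, List.foldl_nil,
      galeStep_galeState hN hD]

theorem length_bits_le {n m : ℕ} (h : n < 2 ^ m) : n.bits.length ≤ m := by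
  rw [Nat.size_eq_bits_len]
  exact Nat.size_le.2 h

/-- The capital's numerator is at most `2 ^ ((k + 1) * w.length)`, so its numeral is linear in the
length of `w`, and so are the other components. The constant is generous. -/
theorem length_galeState_le {N k : ℕ} (r : Str → Str → Bool) (w : Str) :
    (galeState N (2 ^ k) r w).length ≤ (3 * k + 20) * (w.length + 1) := by
  have h0 : N * (w.length / N) ≤ w.length := Nat.mul_div_le _ _
  have h1 : (N * (w.length / N) + 1).bits.length ≤ w.length + 1 :=
    length_bits_le (lt_of_le_of_lt (by omega) Nat.lt_two_pow_self)
  have hh := hits_add_misses (blockPredictor N fun m n => r (stdString m) (stdString n)) [] w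
  have h2 : ((2 ^ k + 1) ^ hits (blockPredictor N fun m n => r (stdString m) (stdString n))
      [] w).bits.length ≤ (k + 1) * w.length + 1 := by
    refine length_bits_le (lt_of_le_of_lt (b := 2 ^ ((k + 1) * w.length)) ?_
      (Nat.pow_lt_pow_right (by omega) (by omega)))
    rw [pow_mul]
    refine (Nat.pow_le_pow_left ?_ _).trans (Nat.pow_le_pow_right (by positivity)
      (show _ ≤ w.length by omega))
    have := Nat.one_le_two_pow (n := k)
    rw [pow_succ]; omega
  have h3 : ((2 ^ k) ^ w.length).bits.length ≤ k * w.length + 1 := by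
    refine length_bits_le ?_
    rw [← pow_mul]
    exact Nat.pow_lt_pow_right (by omega) (by omega)
  have h4 : (w.drop (N * (w.length / N))).reverse.length ≤ w.length := by simp
  simp only [galeState, length_pair]
  nlinarith

theorem realComputable_predictorGale {N k : ℕ} (hN : 0 < N) {r : Str → Str → Bool}
    (hr : ∀ u v : Str → Str, InPlace g u → InPlace g v → InPlace g fun x => [r (u x) (v x)]) :
    RealComputable (pRel g)
      (predictorGale (blockPredictor N fun m n => r (stdString m) (stdString n)) (2 ^ k)) := by
  set π := blockPredictor N fun m n => r (stdString m) (stdString n) with hπ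
  -- The capital is rational and computed exactly, so the precision plays no role.
  refine ⟨fun _ w => (((2 ^ k + 1) ^ hits π [] w : ℕ) : ℚ≥0) / (((2 ^ k) ^ w.length : ℕ) : ℚ≥0),
    fun n w => ?_, fun x => snd (snd (galeState N (2 ^ k) r (snd x))), ?_, fun n w => ?_⟩
  · simp [predictorGale]
  · rw [← inPlace_iff_mem_pRel]
    refine InPlace.snd.comp (InPlace.snd.comp ?_)
    obtain ⟨Q, hQ⟩ := (InPlace.snd (g := g)).exists_length_le
    -- Every intermediate accumulator is the state of a prefix, which gives the polynomial bound
    -- that iteration requires.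
    convert InPlace.foldl (InPlace.galeStep N (2 ^ k) hr) InPlace.snd
      (InPlace.const (galeState N (2 ^ k) r [])) (Polynomial.C (3 * k + 20) * (Q + 1))
      (fun x v hv => ?_) using 2 with x
    · rw [foldl_galeStep hN (by positivity)]
    · rw [foldl_galeStep hN (by positivity)]
      refine (length_galeState_le r v).trans ?_
      simp only [Polynomial.eval_mul, Polynomial.eval_C, Polynomial.eval_add, Polynomial.eval_one]
      exact Nat.mul_le_mul_left _ (Nat.succ_le_succ (hv.length_le.trans (hQ x)))
  · refine ⟨(2 ^ k + 1) ^ hits π [] w, (2 ^ k) ^ w.length, by positivity, ?_, rfl⟩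
    simp [galeState, hπ]

end SelDim

/-! ### Conclusion -/

open SelDim in
theorem mainTheorem2 (g : SelDim.Str → SelDim.Str) (A B : Set SelDim.Str)
    (hB : SelDim.Selective (SelDim.pRel g) B) (hAB : SelDim.ManyOnePoly A B) :
    SelDim.dim (SelDim.pRel g) A = 0 := by
  obtain ⟨f, hf, hsel⟩ := hB
  obtain ⟨h, hh, hA⟩ := hAB
  have hf := inPlace_of_mem_pRel hf
  have hh := inPlace_of_mem_pRel (p_subset_pRel g hh)
  -- The comparison records whether the selector picks the image of `a`. If it does, `b ∈ A` forces
  -- `a ∈ A`; otherwise it picks the image of `b`, and the converse holds.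
  let r : Str → Str → Bool := fun a b => decide (h a = f (pair (h a) (h b)))
  have hr (u v : Str → Str) (hu : InPlace g u) (hv : InPlace g v) :
      InPlace g fun x => [r (u x) (v x)] :=
    (hh.comp hu).eq (hf.comp ((hh.comp hu).pair (hh.comp hv)))
  have hR (m n : ℕ) : (r (stdString m) (stdString n) = true → stdString n ∈ A → stdString m ∈ A) ∧
      (r (stdString m) (stdString n) = false → stdString m ∈ A → stdString n ∈ A) := by
    simp only [r, decide_eq_true_eq, decide_eq_false_iff_not, hA]
    obtain ⟨h1, h2⟩ := hsel (h (stdString m)) (h (stdString n))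
    refine ⟨fun e hn => ?_, fun e hm => ?_⟩
    · rw [e]; exact h2 (.inr hn)
    · rw [← h1.resolve_left (Ne.symm e)]; exact h2 (.inl hm)
  have hs (k : ℕ) : 0 ≤ Real.logb 2 (1 + 2 / 2 ^ k) :=
    Real.logb_nonneg (by norm_num) (le_add_of_nonneg_right (by positivity))
  have hmem (k : ℕ) : (Real.logb 2 (1 + 2 / 2 ^ k)).toNNReal ∈ galeSet (pRel g) {A} := by
    obtain ⟨N, hN⟩ := exists_block_length k
    have hN0 : 0 < N := by
      rcases Nat.eq_zero_or_pos N with rfl | h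
      · simp at hN
      · exact h
    refine ⟨_, isGale_predictorGale _ (D := 2 ^ k) (by positivity) ?_,
      realComputable_predictorGale hN0 hr, ?_⟩
    · rw [Real.coe_toNNReal _ (hs k), Real.rpow_logb (by norm_num) (by norm_num) (by positivity)]
      push_cast; rfl
    · rintro _ rfl
      exact succeeds_predictorGale hR hN
  -- The exponents solving `2 ^ s = 1 + 2 / 2 ^ k` tend to `logb 2 1 = 0`, which squeezes the
  -- infimum to zero.
  have hlim : Filter.Tendsto (fun k : ℕ => ((Real.logb 2 (1 + 2 / 2 ^ k)).toNNReal : ENNReal))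
      Filter.atTop (nhds 0) := by
    have h1 : Filter.Tendsto (fun k : ℕ => (1 : ℝ) + 2 / 2 ^ k) Filter.atTop (nhds (1 + 0)) := by
      refine tendsto_const_nhds.add ?_
      have := (tendsto_pow_atTop_nhds_zero_of_lt_one (r := (1 / 2 : ℝ)) (by norm_num)
        (by norm_num)).const_mul 2
      simpa [div_eq_mul_inv] using this
    rw [add_zero] at h1
    have h2 := (Real.continuousAt_logb (b := 2) one_ne_zero).tendsto.comp h1
    rw [Real.logb_one] at h2
    have h3 := ENNReal.tendsto_ofReal h2
    rwa [ENNReal.ofReal_zero] at h3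
  refine le_antisymm (ge_of_tendsto' hlim fun k => ?_) zero_le
  exact iInf₂_le _ (hmem k)
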